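/- All graphs are finite and simple. A degree sequence is a nonincreasing list $d=(d_1,\dots,d_m)$ of nonnegative integers that is the list of vertex degrees of some graph; a labeled realization of $d$ is a graph on the fixed vertex set $\{v_1,\dots,v_m\}$ in which each $v_i$ has degree $d_i$. The realization graph $\mathcal{G}(d)$ has the labeled realizations of $d$ as its vertices, two realizations being adjacent if one is obtained from the other by a single 2-switch, that is, by deleting two edges $uv,wx$ and adding two edges $ux,vw$, where $u,v,w,x$ are four distinct vertices such that $uv,wx$ are edges and $ux,vw$ are non-edges. A threshold sequence is a degree sequence with exactly one labeled realization. A splitted degree sequence $p=(p_2;p_1)$ is a pair of nonincreasing lists (either may be empty) whose concatenation has a realization in which the vertices with degrees listed in $p_2$ form a clique and those with degrees listed in $p_1$ form an independent set; $p$ is regarded as a way of writing the degree sequence $p_2,p_1$. For a splitted degree sequence $p=(p_2;p_1)$ and a degree sequence $q$, the Tyshkevich composition $p\circ q$ is the concatenation of the terms of $p_2$ each augmented by $|q|$, the terms of $q$ each augmented by $|p_2|$, and the terms of $p_1$, where $|\cdot|$ denotes the length of a list. Let $k^{(r)}$ denote $r$ consecutive terms equal to $k$. **Theorem.** Let $n\ge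 4$ and let $d$ be a degree sequence. Then $\mathcal{G}(d)$ is a complete graph of order $n$ (is isomorphic to $K_n$) if and only if $d=t\circ(\alpha\circ t')$, where each of $t,t'$ is either empty or a threshold sequence, $\alpha$ is one of the degree sequences $\left(n,2,1^{(n)}\right)$ and $\left(n^{(n)},n-1,1\right)$, and $t$ and $\alpha$ are written as splitted degree sequences. -/

import Mathlib

namespace DegSeq

/-- The graph `G`, on the vertex set `{0, …, d.length - 1}`, is a labeled realization of the list
`d`: the vertex `i` has degree `d[i]`. -/
def IsRealization (d : List ℕ) (G : SimpleGraph (Fin d.length)) : Prop :=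
  ∀ i, (G.neighborSet i).ncard = d.get i

/-- A degree sequence: a list of natural numbers in nonincreasing order that is the list of vertex
degrees of some finite simple graph. -/
def IsDegreeSequence (d : List ℕ) : Prop :=
  d.Pairwise (· ≥ ·) ∧ ∃ G, IsRealization d G

/-- The labeled realizations of `d`. -/
abbrev Realization (d : List ℕ) : Type :=
  {G : SimpleGraph (Fin d.length) // IsRealization d G}

/-- `u, v, w, x` are four distinct vertices forming an alternating 4-cycle `[u, v : w, x]` of `H`:
`uv` and `wx` are edges, `ux` and `vw` are non-edges. -/
def IsAlternating {V : Type*} (H : SimpleGraph V) (u v w x : V) : Prop :=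
  [u, v, w, x].Nodup ∧ H.Adj u v ∧ H.Adj w x ∧ ¬ H.Adj u x ∧ ¬ H.Adj v w

/-- `J` is obtained from `H` by a single 2-switch: for some alternating 4-cycle `[u, v : w, x]` of
`H`, the edges `uv`, `wx` are deleted and the edges `ux`, `vw` are added. -/
def TwoSwitch {V : Type*} (H J : SimpleGraph V) : Prop :=
  ∃ u v w x : V, IsAlternating H u v w x ∧
    J.edgeSet = (H.edgeSet \ {s(u, v), s(w, x)}) ∪ {s(u, x), s(v, w)}

theorem TwoSwitch.symm {V : Type*} {H J : SimpleGraph V} (h : TwoSwitch H J) : TwoSwitch J H := by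
  obtain ⟨u, v, w, x, ⟨hn, huv, hwx, hux, hvw⟩, hJ⟩ := h
  have hadj : ∀ a b, J.Adj a b ↔
      (H.Adj a b ∧ ¬ (s(a, b) = s(u, v) ∨ s(a, b) = s(w, x))) ∨
        (s(a, b) = s(u, x) ∨ s(a, b) = s(v, w)) := by
    intro a b
    rw [← SimpleGraph.mem_edgeSet, hJ]
    simp only [Set.mem_union, Set.mem_sdiff, Set.mem_insert_iff, Set.mem_singleton_iff,
      SimpleGraph.mem_edgeSet]
  simp only [List.nodup_cons, List.mem_cons, List.not_mem_nil, or_false, not_or, not_false_eq_true,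
    List.nodup_nil, and_true] at hn
  obtain ⟨⟨h1, h2, h3⟩, ⟨h4, h5⟩, h6⟩ := hn
  refine ⟨v, w, x, u, ⟨?_, ?_, ?_, ?_, ?_⟩, ?_⟩
  · simp only [List.nodup_cons, List.mem_cons, List.not_mem_nil, or_false, not_or,
      not_false_eq_true, List.nodup_nil, and_true]
    exact ⟨⟨h4, h5, Ne.symm h1⟩, ⟨h6, Ne.symm h2⟩, Ne.symm h3⟩
  · rw [hadj]; simp
  · rw [hadj]; simp
  · rw [hadj]; simp; grind
  · rw [hadj]; simp; grind
  · ext e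
    induction e with
    | _ a b =>
      have hux' : ¬ H.Adj x u := fun h => hux h.symm
      have hvw' : ¬ H.Adj w v := fun h => hvw h.symm
      have huv' := huv.symm
      have hwx' := hwx.symm
      simp only [SimpleGraph.mem_edgeSet, Set.mem_union, Set.mem_sdiff, Set.mem_insert_iff,
        Set.mem_singleton_iff, hadj, Sym2.eq_iff]
      grind

theorem TwoSwitch.irrefl {V : Type*} (H : SimpleGraph V) : ¬ TwoSwitch H H := by
  rintro ⟨u, v, w, x, ⟨_, _, _, hux, _⟩, hJ⟩
  apply hux
  rw [← SimpleGraph.mem_edgeSet, hJ]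
  simp

/-- The realization graph of `d`: its vertices are the labeled realizations of `d`, two of them
being adjacent when they differ by a single 2-switch. -/
def realizationGraph (d : List ℕ) : SimpleGraph (Realization d) where
  Adj H J := TwoSwitch H.1 J.1
  symm := ⟨fun _ _ h => h.symm⟩
  loopless := ⟨fun H h => TwoSwitch.irrefl H.1 h⟩

/-- A threshold sequence: a degree sequence with exactly one labeled realization. -/
def IsThreshold (d : List ℕ) : Prop :=
  IsDegreeSequence d ∧ ∃! G, IsRealization d G

/-- A list written in splitted form `(clique; indep)`. -/
structure Splitted where
  clique : List ℕ
  indep : List ℕ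

/-- The list `clique, indep` underlying a splitted list. -/
def Splitted.toList (p : Splitted) : List ℕ := p.clique ++ p.indep

/-- `p` is a splitted degree sequence: both parts are nonincreasing, and some realization of the
underlying list has the vertices of `p.clique` forming a clique and those of `p.indep` forming an
independent set (either set may be empty). -/
def Splitted.IsDegreeSequence (p : Splitted) : Prop :=
  p.clique.Pairwise (· ≥ ·) ∧ p.indep.Pairwise (· ≥ ·) ∧
    ∃ G, IsRealization p.toList G ∧
      G.IsClique {i | i.val < p.clique.length} ∧
      G.IsIndepSet {i | p.clique.length ≤ i.val}

/-- The Tyshkevich composition `p ∘ q`. -/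
def Splitted.comp (p : Splitted) (q : List ℕ) : List ℕ :=
  p.clique.map (· + q.length) ++ q.map (· + p.clique.length) ++ p.indep

end DegSeq

/-! Two facts carry the proof. The realization graph of a Tyshkevich composition is the Cartesian
product of the realization graphs of its factors (`exists_iso_boxProd`, `exists_iso_comp`), and the
core sequences have realization graph K_n (`exists_iso_coreDeg`). Threshold sequences contribute
one-vertex factors, which gives the "if" direction.

For the converse, a 2-switch is the symmetric difference of the edge set with the four pairs of an
alternating 4-cycle. If all realizations of the degrees of H are mutually adjacent, then any two
alternating 4-cycles of H share at least two pairs (`two_le_card_inter`), hence either a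
three-vertex path or two opposite pairs. Since n ≥ 4, H has at least three alternating 4-cycles;
opposite pairs would allow only two, so all the cycles consist of one common path u v w and a
varying fourth vertex (`exists_isSunflower`).

After complementing if necessary, u and w are adjacent. The vertices on alternating cycles then
induce a core graph, and each other vertex is adjacent to all of them, to none, or exactly to u and
w; any other pattern would create a further alternating cycle. This exhibits H as an iterated join
of a split graph, the core and a remaining graph (`CoreSet.hasCore`). A Cartesian product is
complete only when at most one factor is nontrivial (`of_boxProd_iso_top`), so the outer and inner
factors have unique realizations, and the order of the core is forced by n. -/

open scoped Classical

namespace DegSeq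

/-! ### Realization graphs of degree functions: relabeling and complementation. -/

section

variable {V W : Type}

/-- The graph on the realizations of a prescribed degree function, with 2-switches as edges. -/
def degGraph (δ : V → ℕ) : SimpleGraph {G : SimpleGraph V // ∀ v, (G.neighborSet v).ncard = δ v} where
  Adj H J := TwoSwitch H.1 J.1
  symm := ⟨fun _ _ h => h.symm⟩
  loopless := ⟨fun H h => TwoSwitch.irrefl H.1 h⟩

/-- The degree function of a graph. -/
noncomputable def deg (G : SimpleGraph V) (v : V) : ℕ := (G.neighborSet v).ncard

theorem twoSwitch_iff {H J : SimpleGraph V} : TwoSwitch H J ↔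
    ∃ u v w x : V, IsAlternating H u v w x ∧ ∀ a b, J.Adj a b ↔
      (H.Adj a b ∧ ¬ (s(a, b) = s(u, v) ∨ s(a, b) = s(w, x))) ∨
        (s(a, b) = s(u, x) ∨ s(a, b) = s(v, w)) := by
  unfold TwoSwitch
  refine exists_congr fun u => exists_congr fun v => exists_congr fun w => exists_congr fun x =>
    and_congr_right fun _ => ?_
  rw [Set.ext_iff, Sym2.forall]
  simp only [Set.mem_union, Set.mem_sdiff, Set.mem_insert_iff, Set.mem_singleton_iff,
    SimpleGraph.mem_edgeSet]

theorem isAlternating_iff {H : SimpleGraph V} {u v w x : V} : IsAlternating H u v w x ↔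
    (u ≠ v ∧ u ≠ w ∧ u ≠ x ∧ v ≠ w ∧ v ≠ x ∧ w ≠ x) ∧
      H.Adj u v ∧ H.Adj w x ∧ ¬ H.Adj u x ∧ ¬ H.Adj v w := by
  simp [IsAlternating, and_assoc]

theorem TwoSwitch.map {H J : SimpleGraph V} (h : TwoSwitch H J) (f : W ≃ V) :
    TwoSwitch (H.comap f) (J.comap f) := by
  rw [twoSwitch_iff] at h ⊢
  obtain ⟨u, v, w, x, h, hJ⟩ := h
  refine ⟨f.symm u, f.symm v, f.symm w, f.symm x, ?_, ?_⟩
  · rw [isAlternating_iff] at h ⊢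
    simpa using h
  · intro a b
    simp only [SimpleGraph.comap_adj, hJ, Sym2.eq_iff, Equiv.eq_symm_apply]

theorem TwoSwitch.compl {H J : SimpleGraph V} (h : TwoSwitch H J) : TwoSwitch Hᶜ Jᶜ := by
  rw [twoSwitch_iff] at h ⊢
  obtain ⟨u, v, w, x, h, hJ⟩ := h
  rw [isAlternating_iff] at h
  refine ⟨v, w, x, u, ?_, ?_⟩
  · rw [isAlternating_iff]
    simp only [SimpleGraph.compl_adj]
    have := H.adj_comm
    grind
  · intro a b
    simp only [SimpleGraph.compl_adj, hJ, Sym2.eq_iff]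
    have := H.adj_comm
    grind

theorem deg_comap (G : SimpleGraph V) (f : W ≃ V) (w : W) : deg (G.comap f) w = deg G (f w) := by
  unfold deg
  rw [← Set.ncard_image_of_injective _ f.injective]
  congr 1
  ext v
  simp only [Set.mem_image, SimpleGraph.mem_neighborSet, SimpleGraph.comap_adj]
  exact ⟨by rintro ⟨x, h, rfl⟩; exact h, fun h => ⟨f.symm v, by simpa using h, by simp⟩⟩

theorem deg_compl [Finite V] (G : SimpleGraph V) (v : V) :
    deg Gᶜ v = Nat.card V - 1 - deg G v := by
  unfold deg
  rw [SimpleGraph.neighborSet_compl, Set.ncard_sdiff (by simp), Set.ncard_compl]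
  · simp; omega

theorem deg_le [Finite V] (G : SimpleGraph V) (v : V) : deg G v ≤ Nat.card V - 1 := by
  have h : G.neighborSet v ⊆ {v}ᶜ := fun x hx => by
    simpa using (G.ne_of_adj hx).symm
  have := Set.ncard_le_ncard h
  rwa [Set.ncard_compl, Set.ncard_singleton] at this

/-- Relabeling the vertices does not change the realization graph. -/
def degGraphEquiv (δ : V → ℕ) (f : W ≃ V) : degGraph (δ ∘ f) ≃g degGraph δ where
  toFun G := ⟨G.1.comap f.symm, fun v => by
    have := deg_comap G.1 f.symm v
    unfold deg at this
    rw [this, G.2]; simp⟩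
  invFun G := ⟨G.1.comap f, fun v => by
    have := deg_comap G.1 f v
    unfold deg at this
    rw [this, G.2]; simp⟩
  left_inv G := by ext; simp
  right_inv G := by ext; simp
  map_rel_iff' {G G'} := by
    constructor
    · intro h
      have e : ∀ K : SimpleGraph W, (K.comap f.symm).comap f = K := fun K => by ext; simp
      have := TwoSwitch.map (H := G.1.comap f.symm) (J := G'.1.comap f.symm) h f
      rw [e, e] at this
      exact this
    · exact fun h => TwoSwitch.map h f.symm

/-- Complementing all realizations. -/
noncomputable def degGraphCompl [Finite V] (δ δ' : V → ℕ) (h : ∀ v, δ' v + δ v = Nat.card V - 1) :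
    degGraph δ ≃g degGraph δ' where
  toFun G := ⟨G.1ᶜ, fun v => by
    have := deg_compl G.1 v
    unfold deg at this
    rw [this, G.2]; have := h v; omega⟩
  invFun G := ⟨G.1ᶜ, fun v => by
    have := deg_compl G.1 v
    unfold deg at this
    rw [this, G.2]; have := h v; omega⟩
  left_inv G := by simp
  right_inv G := by simp
  map_rel_iff' {G G'} := by
    constructor
    · intro h
      have := TwoSwitch.compl (H := G.1ᶜ) (J := G'.1ᶜ) h
      rw [compl_compl, compl_compl] at this
      exact this
    · exact fun h => TwoSwitch.compl h

theorem exists_perm_map_eq {l : List ℕ} {s : List V} {f : V → ℕ} (h : l.Perm (s.map f)) :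
    ∃ s' : List V, s'.Perm s ∧ s'.map f = l := by
  induction l generalizing s with
  | nil =>
    have : s = [] := by simpa using h.symm.eq_nil
    exact ⟨[], by simp [this], rfl⟩
  | cons a l ih =>
    have ha : a ∈ s.map f := h.subset (by simp)
    obtain ⟨v, hv, rfl⟩ := List.mem_map.1 ha
    have h2 := List.perm_cons_erase hv
    obtain ⟨s', h3, h4⟩ := ih (s := s.erase v)
      ((List.perm_cons (f v)).1 (h.trans (by simpa using h2.map f)))
    exact ⟨v :: s', (h3.cons v).trans h2.symm, by simp [h4]⟩

theorem exists_equiv_of_multiset_eq [Fintype V] {δ : V → ℕ} {d : List ℕ}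
    (h : (d : Multiset ℕ) = Finset.univ.val.map δ) :
    ∃ f : Fin d.length ≃ V, d.get = δ ∘ f := by
  have h' : d.Perm ((Finset.univ : Finset V).toList.map δ) := by
    rw [← Multiset.coe_eq_coe, h, ← Multiset.map_coe, Finset.coe_toList]
  obtain ⟨s, hs, rfl⟩ := exists_perm_map_eq h'
  have hn : s.Nodup := hs.nodup_iff.2 (Finset.nodup_toList _)
  have hm : ∀ v, v ∈ s := fun v => hs.mem_iff.2 (by simp)
  refine ⟨(finCongr (by simp)).trans (hn.getEquivOfForallMemList s hm), ?_⟩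
  ext i
  simp

/-- Only the multiset of degrees matters, so any convenient vertex type, such as a sum type, can
replace `Fin d.length`. -/
theorem exists_iso_of_multiset_eq [Fintype V] {δ : V → ℕ} {d : List ℕ}
    (h : (d : Multiset ℕ) = Finset.univ.val.map δ) :
    Nonempty (realizationGraph d ≃g degGraph δ) := by
  obtain ⟨f, hf⟩ := exists_equiv_of_multiset_eq h
  have := degGraphEquiv δ f
  rw [← hf] at this
  exact ⟨this⟩

end

/-! ### Joins of graphs and Cartesian products of realization graphs. -/

section

variable {P Q : Type}

/-- The graph on `P ⊕ Q` inducing `G₁` on `P` and `G₂` on `Q`, in which the vertices of `K` are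
adjacent to all of `Q` and the other vertices of `P` to none of `Q`. -/
def join (K : Set P) (G₁ : SimpleGraph P) (G₂ : SimpleGraph Q) : SimpleGraph (P ⊕ Q) where
  Adj
    | .inl p, .inl p' => G₁.Adj p p'
    | .inl p, .inr _ => p ∈ K
    | .inr _, .inl p => p ∈ K
    | .inr q, .inr q' => G₂.Adj q q'
  symm := ⟨by
    rintro (p | q) (p' | q') h
    · exact G₁.adj_symm h
    · exact h
    · exact h
    · exact G₂.adj_symm h⟩
  loopless := ⟨by
    rintro (p | q) h
    · exact G₁.loopless.irrefl _ h
    · exact G₂.loopless.irrefl _ h⟩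

section
variable {K : Set P} {G₁ : SimpleGraph P} {G₂ : SimpleGraph Q}

@[simp] theorem join_inl_inl {p p' : P} :
    (join K G₁ G₂).Adj (.inl p) (.inl p') ↔ G₁.Adj p p' := Iff.rfl
@[simp] theorem join_inl_inr {p : P} {q : Q} :
    (join K G₁ G₂).Adj (.inl p) (.inr q) ↔ p ∈ K := Iff.rfl
@[simp] theorem join_inr_inl {p : P} {q : Q} :
    (join K G₁ G₂).Adj (.inr q) (.inl p) ↔ p ∈ K := Iff.rfl
@[simp] theorem join_inr_inr {q q' : Q} :
    (join K G₁ G₂).Adj (.inr q) (.inr q') ↔ G₂.Adj q q' := Iff.rfl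

theorem compl_join : (join K G₁ G₂)ᶜ = join Kᶜ G₁ᶜ G₂ᶜ := by
  ext (p | q) (p' | q') <;> simp

theorem join_inj {G₁' : SimpleGraph P} {G₂' : SimpleGraph Q} :
    join K G₁ G₂ = join K G₁' G₂' ↔ G₁ = G₁' ∧ G₂ = G₂' := by
  constructor
  · intro h
    constructor
    · ext p p'
      rw [← join_inl_inl (K := K) (G₂ := G₂), h, join_inl_inl]
    · ext p p'
      rw [← join_inr_inr (K := K) (G₁ := G₁), h, join_inr_inr]
  · rintro ⟨rfl, rfl⟩; rfl

end

theorem deg_join_inl [Finite P] [Finite Q] (K : Set P) (G₁ : SimpleGraph P) (G₂ : SimpleGraph Q)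
    (p : P) :
    deg (join K G₁ G₂) (.inl p) = deg G₁ p + if p ∈ K then Nat.card Q else 0 := by
  have : (join K G₁ G₂).neighborSet (.inl p) =
      Sum.inl '' G₁.neighborSet p ∪ Sum.inr '' {_q : Q | p ∈ K} := by
    ext (x | x) <;> simp
  unfold deg
  rw [this, Set.ncard_union_eq _ (Set.toFinite _) (Set.toFinite _),
    Set.ncard_image_of_injective _ Sum.inl_injective,
    Set.ncard_image_of_injective _ Sum.inr_injective]
  · split_ifs with h <;> simp [h]
  · rw [Set.disjoint_left]; rintro _ ⟨x, _, rfl⟩; simp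

theorem deg_join_inr [Finite P] [Finite Q] (K : Set P) (G₁ : SimpleGraph P) (G₂ : SimpleGraph Q)
    (q : Q) :
    deg (join K G₁ G₂) (.inr q) = deg G₂ q + K.ncard := by
  have : (join K G₁ G₂).neighborSet (.inr q) =
      Sum.inr '' G₂.neighborSet q ∪ Sum.inl '' K := by
    ext (x | x) <;> simp
  unfold deg
  rw [this, Set.ncard_union_eq _ (Set.toFinite _) (Set.toFinite _),
    Set.ncard_image_of_injective _ Sum.inl_injective,
    Set.ncard_image_of_injective _ Sum.inr_injective]
  · rw [Set.disjoint_left]; rintro _ ⟨x, _, rfl⟩; simp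

/-- The degree function of the join of graphs with given degree functions. -/
noncomputable def joinDeg (K : Set P) (δ₁ : P → ℕ) (δ₂ : Q → ℕ) : P ⊕ Q → ℕ :=
  Sum.elim (fun p => δ₁ p + if p ∈ K then Nat.card Q else 0) (fun q => δ₂ q + K.ncard)

theorem deg_join [Finite P] [Finite Q] (K : Set P) (G₁ : SimpleGraph P) (G₂ : SimpleGraph Q) :
    deg (join K G₁ G₂) = joinDeg K (deg G₁) (deg G₂) := by
  ext (p | q)
  · exact deg_join_inl ..
  · exact deg_join_inr ..

theorem deg_eq_sum {V : Type} [Fintype V] (G : SimpleGraph V) (v : V) :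
    (deg G v : ℤ) = ∑ w, if G.Adj v w then 1 else 0 := by
  unfold deg
  rw [Set.ncard_eq_toFinset_card', Finset.sum_boole]
  congr 2
  ext; simp

/-- The signed degree sum over `P`, counting pairs within `P` symmetrically. -/
theorem two_mul_sum_sign_mul_deg [Fintype P] [Fintype Q] (s : P → ℤ) (G : SimpleGraph (P ⊕ Q)) :
    2 * ∑ p, s p * deg G (.inl p) =
      ∑ p, ((∑ p', (s p + s p') * if G.Adj (.inl p) (.inl p') then 1 else 0) +
        ∑ q : Q, 2 * s p * if G.Adj (.inl p) (.inr q) then 1 else 0) := by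
  simp only [deg_eq_sum, Fintype.sum_sum_type, mul_add, Finset.sum_add_distrib, add_mul,
    Finset.mul_sum]
  have h : ∑ p, ∑ p', s p' * (if G.Adj (.inl p) (.inl p') then (1 : ℤ) else 0) =
      ∑ p, ∑ p', s p * (if G.Adj (.inl p) (.inl p') then (1 : ℤ) else 0) := by
    rw [Finset.sum_comm]
    simp only [G.adj_comm]
  rw [h]
  simp only [two_mul, add_mul, Finset.sum_add_distrib]

/-- A graph whose degrees on `P` are those of a join with split `G₁` is itself such a join. -/
theorem eq_join_of_deg_eq [Finite P] [Finite Q] {K : Set P} {G₁ : SimpleGraph P}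
    (hK : G₁.IsClique K) (hI : G₁.IsIndepSet Kᶜ) {G : SimpleGraph (P ⊕ Q)}
    (hG : ∀ p, deg G (.inl p) = deg G₁ p + if p ∈ K then Nat.card Q else 0) :
    G = join K (G.comap .inl) (G.comap .inr) := by
  have := Fintype.ofFinite P
  have := Fintype.ofFinite Q
  -- Extremal argument: the signed degree sum over P is a sum of pair contributions with
  -- coefficients 2 within K, -2 within the complement, 0 for mixed pairs in P, and ±2 for pairs
  -- between P and Q. The join `J` maximizes every contribution at once and has the same sum as `G`,
  -- so equality holds term by term. Pairs within Q do not enter, hence the arbitrary choice of ⊥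
  -- there.
  let s : P → ℤ := fun p => if p ∈ K then 1 else -1
  let J := join K G₁ (⊥ : SimpleGraph Q)
  have h : ∑ p, s p * (deg G (.inl p) : ℤ) = ∑ p, s p * (deg J (.inl p) : ℤ) := by
    simp only [hG, J, deg_join_inl]
  have h2 := congrArg (2 * ·) h
  simp only [two_mul_sum_sign_mul_deg] at h2
  have le1 : ∀ p p', (s p + s p') * (if G.Adj (.inl p) (.inl p') then (1 : ℤ) else 0) ≤
      (s p + s p') * (if J.Adj (.inl p) (.inl p') then (1 : ℤ) else 0) := by
    intro p p'
    by_cases hp : p ∈ K <;> by_cases hp' : p' ∈ K <;> simp only [s, hp, hp', J, join_inl_inl]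
    · by_cases e : p = p'
      · subst e; simp
      · simp only [hK hp hp' e]; split_ifs <;> simp
    · simp
    · simp
    · by_cases e : p = p'
      · subst e; simp
      · simp only [hI hp hp' e]; split_ifs <;> simp
  have le2 : ∀ p (q : Q), 2 * s p * (if G.Adj (.inl p) (.inr q) then (1 : ℤ) else 0) ≤
      2 * s p * (if J.Adj (.inl p) (.inr q) then (1 : ℤ) else 0) := by
    intro p q
    by_cases hp : p ∈ K <;> simp only [s, hp, J, join_inl_inr] <;> split_ifs <;> simp
  have h3 := (Finset.sum_eq_sum_iff_of_le fun p _ => add_le_add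
    (Finset.sum_le_sum fun p' _ => le1 p p') (Finset.sum_le_sum fun q _ => le2 p q)).1 h2
  have h4 : ∀ p, ∀ q, 2 * s p * (if G.Adj (.inl p) (.inr q) then (1 : ℤ) else 0) =
      2 * s p * (if J.Adj (.inl p) (.inr q) then (1 : ℤ) else 0) := by
    intro p q
    have a := Finset.sum_le_sum fun p' (_ : p' ∈ Finset.univ) => le1 p p'
    have b := Finset.sum_le_sum fun q (_ : q ∈ Finset.univ) => le2 p q
    exact (Finset.sum_eq_sum_iff_of_le fun q _ => le2 p q).1
      (le_antisymm b (by have := h3 p (Finset.mem_univ _); linarith)) q (Finset.mem_univ _)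
  have h5 : ∀ p (q : Q), G.Adj (.inl p) (.inr q) ↔ p ∈ K := by
    intro p q
    have := h4 p q
    by_cases hp : p ∈ K <;> simp only [s, hp, J, join_inl_inr] at this ⊢ <;>
      split_ifs at this <;> simp_all
  ext (p | q) (p' | q')
  · rfl
  · exact h5 p q'
  · rw [G.adj_comm]; exact h5 p' q
  · rfl

/-- A 4-cycle meeting both sides has a pair crossing between them, and a 2-switch changes that pair,
whereas the two joins agree on all crossing pairs. So the cycle lies within one side. -/
theorem twoSwitch_join {K : Set P} {G₁ G₁' : SimpleGraph P} {G₂ G₂' : SimpleGraph Q} :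
    TwoSwitch (join K G₁ G₂) (join K G₁' G₂') ↔
      (TwoSwitch G₁ G₁' ∧ G₂ = G₂') ∨ (TwoSwitch G₂ G₂' ∧ G₁ = G₁') := by
  simp only [twoSwitch_iff, isAlternating_iff]
  constructor
  · rintro ⟨u, v, w, x, ⟨hd, huv, hwx, hux, hvw⟩, h⟩
    have huv' := h u v
    have hwx' := h w x
    have hux' := h u x
    have hvw' := h v w
    rcases u with u | u <;> rcases v with v | v <;> rcases w with w | w <;> rcases x with x | x <;>
      try (exfalso; simp_all; done)
    · left
      constructor
      · refine ⟨u, v, w, x, ⟨by simpa using hd, huv, hwx, hux, hvw⟩, fun a b => ?_⟩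
        have := h (.inl a) (.inl b)
        simpa using this
      · ext a b
        have := h (.inr a) (.inr b)
        simp at this
        exact this.symm
    · right
      constructor
      · refine ⟨u, v, w, x, ⟨by simpa using hd, huv, hwx, hux, hvw⟩, fun a b => ?_⟩
        have := h (.inr a) (.inr b)
        simpa using this
      · ext a b
        have := h (.inl a) (.inl b)
        simp at this
        exact this.symm
  · rintro (⟨⟨u, v, w, x, ⟨hd, huv, hwx, hux, hvw⟩, h⟩, rfl⟩ |
      ⟨⟨u, v, w, x, ⟨hd, huv, hwx, hux, hvw⟩, h⟩, rfl⟩)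
    · refine ⟨.inl u, .inl v, .inl w, .inl x, ⟨by simpa using hd, huv, hwx, hux, hvw⟩, ?_⟩
      rintro (a | a) (b | b) <;> simp [h]
    · refine ⟨.inr u, .inr v, .inr w, .inr x, ⟨by simpa using hd, huv, hwx, hux, hvw⟩, ?_⟩
      rintro (a | a) (b | b) <;> simp [h]

/-- The realization graph of a composition is the Cartesian product of the realization graphs. -/
theorem exists_iso_boxProd [Finite P] [Finite Q] {K : Set P} {G₁ : SimpleGraph P}
    (hK : G₁.IsClique K) (hI : G₁.IsIndepSet Kᶜ) (δ₂ : Q → ℕ) :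
    Nonempty (degGraph (joinDeg K (deg G₁) δ₂) ≃g degGraph (deg G₁) □ degGraph δ₂) := by
  let F : {G : SimpleGraph P // ∀ v, (G.neighborSet v).ncard = deg G₁ v} ×
      {G : SimpleGraph Q // ∀ v, (G.neighborSet v).ncard = δ₂ v} →
      {G : SimpleGraph (P ⊕ Q) // ∀ v, (G.neighborSet v).ncard = joinDeg K (deg G₁) δ₂ v} :=
    fun G => ⟨join K G.1.1 G.2.1, fun v => by
      have := congrFun (deg_join K G.1.1 G.2.1) v
      rw [show deg G.1.1 = deg G₁ from funext G.1.2, show deg G.2.1 = δ₂ from funext G.2.2] at this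
      exact this⟩
  have hF : Function.Bijective F := by
    constructor
    · rintro ⟨A, B⟩ ⟨A', B'⟩ h
      have := join_inj.1 (Subtype.ext_iff.1 h)
      exact Prod.ext (Subtype.ext this.1) (Subtype.ext this.2)
    · rintro ⟨G, hG⟩
      have hG' : deg G = joinDeg K (deg G₁) δ₂ := funext hG
      -- Surjectivity is the only place where the split structure of `G₁` is needed.
      have e := eq_join_of_deg_eq hK hI fun p => congrFun hG' (.inl p)
      have e1 := deg_join K (G.comap Sum.inl) (G.comap Sum.inr)
      rw [← e, hG'] at e1
      refine ⟨⟨⟨G.comap .inl, fun v => ?_⟩, ⟨G.comap .inr, fun v => ?_⟩⟩, Subtype.ext e.symm⟩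
      · have := congrFun e1 (.inl v)
        simp only [joinDeg, Sum.elim_inl] at this
        exact (add_right_cancel this).symm
      · have := congrFun e1 (.inr v)
        simp only [joinDeg, Sum.elim_inr] at this
        exact (add_right_cancel this).symm
  refine ⟨(RelIso.symm ⟨Equiv.ofBijective F hF, ?_⟩)⟩
  rintro ⟨A, B⟩ ⟨A', B'⟩
  rw [SimpleGraph.boxProd_adj]
  simp only [Equiv.ofBijective_apply, F, degGraph, Subtype.ext_iff]
  exact twoSwitch_join

end

/-! ### From degrees on vertex sets to splitted lists and their compositions. -/

section

variable {P Q : Type}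

/-- The multiset of values of `δ` on `S`. -/
noncomputable def valuesOn [Fintype P] (S : Set P) (δ : P → ℕ) : Multiset ℕ :=
  (Finset.univ.filter (· ∈ S)).val.map δ

theorem valuesOn_eq [Fintype P] {S : Set P} {F : Finset P} (h : ∀ x, x ∈ F ↔ x ∈ S) (δ : P → ℕ) :
    valuesOn S δ = F.val.map δ := by
  rw [valuesOn]
  congr 2
  ext; simp [h]

theorem card_valuesOn [Fintype P] (S : Set P) (δ : P → ℕ) :
    (valuesOn S δ).card = S.ncard := by
  rw [valuesOn, Multiset.card_map, Finset.card_val, Set.ncard_eq_toFinset_card']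
  congr 1; ext; simp

theorem valuesOn_add_compl [Fintype P] (S : Set P) (δ : P → ℕ) :
    valuesOn S δ + valuesOn Sᶜ δ = Finset.univ.val.map δ := by
  unfold valuesOn
  rw [← Multiset.map_add]
  simp only [Finset.filter_val, Set.mem_compl_iff, Multiset.filter_add_not]

theorem map_joinDeg [Fintype P] [Fintype Q] (K : Set P) (δ₁ : P → ℕ) (δ₂ : Q → ℕ) :
    Finset.univ.val.map (joinDeg K δ₁ δ₂) =
      (valuesOn K δ₁).map (· + Fintype.card Q) +
        (Finset.univ.val.map δ₂).map (· + K.ncard) + valuesOn Kᶜ δ₁ := by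
  have h1 : (Finset.univ : Finset (P ⊕ Q)).val.map (joinDeg K δ₁ δ₂) =
      Finset.univ.val.map (fun p => joinDeg K δ₁ δ₂ (.inl p)) +
      Finset.univ.val.map (fun q => joinDeg K δ₁ δ₂ (.inr q)) := by
    rw [← Finset.univ_disjSum_univ, Finset.val_disjSum, Multiset.disjSum, Multiset.map_add,
      Multiset.map_map, Multiset.map_map]
    rfl
  rw [h1, ← valuesOn_add_compl K (fun p => joinDeg K δ₁ δ₂ (.inl p)), add_right_comm]
  unfold valuesOn joinDeg
  simp only [Multiset.map_map, Sum.elim_inl, Sum.elim_inr, Function.comp_def,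
    Nat.card_eq_fintype_card]
  congr 1
  congr 1
  · exact Multiset.map_congr rfl fun p hp => by simp at hp; simp [hp]
  · exact Multiset.map_congr rfl fun p hp => by simp at hp; simp [hp]

/-- The lists of `p` are the degrees of `G` on `K` and on its complement. -/
def Splitted.Lists [Fintype P] (p : Splitted) (K : Set P) (δ : P → ℕ) : Prop :=
  (p.clique : Multiset ℕ) = valuesOn K δ ∧ (p.indep : Multiset ℕ) = valuesOn Kᶜ δ

theorem Splitted.Lists.toList [Fintype P] {p : Splitted} {K : Set P} {δ : P → ℕ}
    (h : p.Lists K δ) : (p.toList : Multiset ℕ) = Finset.univ.val.map δ := by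
  rw [Splitted.toList, ← Multiset.coe_add, h.1, h.2, valuesOn_add_compl]

theorem Splitted.Lists.comp [Fintype P] [Fintype Q] {p : Splitted} {K : Set P} {δ₁ : P → ℕ}
    (h : p.Lists K δ₁) {q : List ℕ} {δ₂ : Q → ℕ} (hq : (q : Multiset ℕ) = Finset.univ.val.map δ₂) :
    (p.comp q : Multiset ℕ) = Finset.univ.val.map (joinDeg K δ₁ δ₂) := by
  have h1 : q.length = Fintype.card Q := by
    rw [← Multiset.coe_card, hq]; simp
  have h2 : p.clique.length = K.ncard := by
    rw [← Multiset.coe_card, h.1, card_valuesOn]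
  rw [map_joinDeg, Splitted.comp, ← Multiset.coe_add, ← Multiset.coe_add, ← Multiset.map_coe,
    ← Multiset.map_coe, h.1, h.2, hq, h1, h2]

section
variable {V : Type} [Finite V] {K : Set V} {G : SimpleGraph V}

theorem deg_le_of_isIndepSet (hI : G.IsIndepSet Kᶜ) {y : V} (hy : y ∉ K) : deg G y ≤ K.ncard := by
  refine Set.ncard_le_ncard (fun z hz => ?_)
  by_contra h
  exact hI hy h (G.ne_of_adj hz) hz

theorem le_deg_of_isClique (hK : G.IsClique K) {x : V} (hx : x ∈ K) : K.ncard ≤ deg G x + 1 := by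
  have : K ⊆ insert x (G.neighborSet x) := fun z hz => by
    by_cases e : z = x
    · simp [e]
    · exact Or.inr (hK hx hz (Ne.symm e))
  exact (Set.ncard_le_ncard this).trans (Set.ncard_insert_le _ _)

/-- If x and y are adjacent, x sees y and the rest of K, so its degree is at least |K|, which bounds
the degree of y. Otherwise every neighbor of y lies in K minus x, hence is a neighbor of x. -/
theorem deg_le_deg_of_split (hK : G.IsClique K) (hI : G.IsIndepSet Kᶜ) {x y : V} (hx : x ∈ K)
    (hy : y ∉ K) : deg G y ≤ deg G x := by
  have h1 := deg_le_of_isIndepSet hI hy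
  by_cases h : G.Adj x y
  · refine h1.trans ?_
    have : insert y (K \ {x}) ⊆ G.neighborSet x := by
      rintro z (rfl | hz)
      · exact h
      · exact hK hx hz.1 (Ne.symm hz.2)
    have := Set.ncard_le_ncard this
    rw [Set.ncard_insert_of_notMem (by simp [hy]), Set.ncard_sdiff_singleton_add_one hx] at this
    exact this
  · refine Set.ncard_le_ncard fun z hz => ?_
    by_contra h'
    have hzK : z ∈ K := by
      by_contra h
      exact hI hy h (G.ne_of_adj hz) hz
    by_cases e : x = z
    · subst e; exact h (G.adj_symm hz)
    · exact h' (hK hx hzK e)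

end

theorem mem_valuesOn [Fintype P] {S : Set P} {δ : P → ℕ} {k : ℕ} :
    k ∈ valuesOn S δ ↔ ∃ p ∈ S, δ p = k := by
  simp [valuesOn]

section
variable [Fintype P] [Fintype Q] {K : Set P} {G₁ : SimpleGraph P} {p : Splitted}
  (hK : G₁.IsClique K) (hI : G₁.IsIndepSet Kᶜ) (h : p.Lists K (deg G₁))
  (hc : p.clique.Pairwise (· ≥ ·)) (hi : p.indep.Pairwise (· ≥ ·))

theorem Splitted.Lists.exists_of_mem_clique {p : Splitted} {δ : P → ℕ} (h : p.Lists K δ) {k : ℕ}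
    (hk : k ∈ p.clique) : ∃ v ∈ K, δ v = k := by
  rw [← mem_valuesOn, ← h.1]; exact hk

theorem Splitted.Lists.exists_of_mem_indep {p : Splitted} {δ : P → ℕ} (h : p.Lists K δ) {k : ℕ}
    (hk : k ∈ p.indep) : ∃ v ∉ K, δ v = k := by
  change ∃ v ∈ Kᶜ, δ v = k
  rw [← mem_valuesOn, ← h.2]; exact hk

include hK hI h hc hi

theorem pairwise_toList : p.toList.Pairwise (· ≥ ·) := by
  rw [Splitted.toList, List.pairwise_append]
  refine ⟨hc, hi, fun a ha b hb => ?_⟩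
  obtain ⟨x, hx, rfl⟩ := h.exists_of_mem_clique ha
  obtain ⟨y, hy, rfl⟩ := h.exists_of_mem_indep hb
  exact deg_le_deg_of_split hK hI hx hy

/-- Clique degrees are at least |K| - 1, terms of q are at most |q| - 1, and independent degrees are
at most |K|; the shifts by |q| and |K| then put the three blocks in order. Sortedness matters
because it upgrades equality of degree multisets to equality of lists. -/
theorem pairwise_comp {q : List ℕ} {G₂ : SimpleGraph Q} (hq : q.Pairwise (· ≥ ·))
    (h₂ : (q : Multiset ℕ) = Finset.univ.val.map (deg G₂)) : (p.comp q).Pairwise (· ≥ ·) := by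
  have hqm : ∀ k ∈ q, k < q.length := by
    intro k hk
    have : k ∈ (q : Multiset ℕ) := hk
    rw [h₂] at this
    obtain ⟨y, -, rfl⟩ := Multiset.mem_map.1 this
    have e : q.length = Nat.card Q := by rw [← Multiset.coe_card, h₂]; simp
    have := deg_le G₂ y
    have : 0 < Nat.card Q := Nat.card_pos_iff.2 ⟨⟨y⟩, inferInstance⟩
    omega
  have hl : p.clique.length = K.ncard := by rw [← Multiset.coe_card, h.1, card_valuesOn]
  rw [Splitted.comp, List.pairwise_append, List.pairwise_append, List.pairwise_map,
    List.pairwise_map]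
  refine ⟨⟨hc.imp fun h => by omega, hq.imp fun h => by omega, ?_⟩, hi, ?_⟩
  · intro a ha b hb
    obtain ⟨a, ha', rfl⟩ := List.mem_map.1 ha
    obtain ⟨b, hb', rfl⟩ := List.mem_map.1 hb
    obtain ⟨x, hx, rfl⟩ := h.exists_of_mem_clique ha'
    have := le_deg_of_isClique hK hx
    have := hqm b hb'
    omega
  · intro a ha b hb
    obtain ⟨y, hy, rfl⟩ := h.exists_of_mem_indep hb
    have h1 := deg_le_of_isIndepSet hI hy
    rcases List.mem_append.1 ha with ha | ha
    · obtain ⟨a, ha', rfl⟩ := List.mem_map.1 ha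
      obtain ⟨x, hx, rfl⟩ := h.exists_of_mem_clique ha'
      have := deg_le_deg_of_split hK hI hx hy
      omega
    · obtain ⟨a, ha', rfl⟩ := List.mem_map.1 ha
      omega

/-- A nonincreasing list of the degrees of a join is a composition. -/
theorem eq_comp {d q : List ℕ} {G₂ : SimpleGraph Q} (hd : d.Pairwise (· ≥ ·))
    (hdm : (d : Multiset ℕ) = Finset.univ.val.map (deg (join K G₁ G₂))) (hq : q.Pairwise (· ≥ ·))
    (h₂ : (q : Multiset ℕ) = Finset.univ.val.map (deg G₂)) : d = p.comp q := by
  have : (d : Multiset ℕ) = p.comp q := by rw [hdm, deg_join, h.comp h₂]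
  exact (Multiset.coe_eq_coe.1 this).eq_of_pairwise (fun a b _ _ h1 h2 => le_antisymm h2 h1) hd
    (pairwise_comp hK hI h hc hi hq h₂)

/-- The realization is `G₁` pulled back along an enumeration of K followed by its complement, each
ordered so that the degrees read off the given lists. -/
theorem isDegreeSequence_of_lists : p.IsDegreeSequence := by
  refine ⟨hc, hi, ?_⟩
  have h1 : p.clique.Perm ((Finset.univ.filter (· ∈ K)).toList.map (deg G₁)) := by
    rw [← Multiset.coe_eq_coe, h.1, ← Multiset.map_coe, Finset.coe_toList, valuesOn]
  have h2 : p.indep.Perm ((Finset.univ.filter (· ∉ K)).toList.map (deg G₁)) := by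
    rw [← Multiset.coe_eq_coe, h.2, ← Multiset.map_coe, Finset.coe_toList,
      valuesOn_eq (F := Finset.univ.filter (· ∉ K)) (by simp)]
  obtain ⟨s, hs, es⟩ := exists_perm_map_eq h1
  obtain ⟨t, ht, et⟩ := exists_perm_map_eq h2
  have ms : ∀ v, v ∈ s ↔ v ∈ K := fun v => by simp [hs.mem_iff]
  have mt : ∀ v, v ∈ t ↔ v ∉ K := fun v => by simp [ht.mem_iff]
  have hn : (s ++ t).Nodup := by
    rw [List.nodup_append]
    refine ⟨hs.nodup_iff.2 (Finset.nodup_toList _), ht.nodup_iff.2 (Finset.nodup_toList _), ?_⟩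
    rintro a ha _ hb rfl
    exact (mt a).1 hb ((ms a).1 ha)
  have hm : ∀ v, v ∈ s ++ t := fun v => by
    rw [List.mem_append, ms, mt]; exact em _
  have ep : p.toList = (s ++ t).map (deg G₁) := by rw [Splitted.toList, ← es, ← et, List.map_append]
  have el : p.clique.length = s.length := by rw [← es]; simp
  let f : Fin p.toList.length ≃ P :=
    (finCongr (by rw [ep]; simp)).trans (hn.getEquivOfForallMemList (s ++ t) hm)
  have hf : ∀ i, f i = (s ++ t)[i.val]'(by have := i.2; have := congrArg List.length ep; simp at this ⊢; omega) := by
    intro i; simp [f]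
  refine ⟨G₁.comap f, fun i => ?_, ?_, ?_⟩
  · have := deg_comap G₁ f i
    unfold deg at this
    rw [this, hf]
    simp only [ep, List.get_eq_getElem, List.getElem_map]
    rfl
  · intro i hi j hj hij
    have key : ∀ i, i ∈ {i : Fin p.toList.length | i.val < p.clique.length} → f i ∈ K := by
      intro i hi
      rw [hf, List.getElem_append_left (by rw [← el]; exact hi), ← ms]
      exact List.getElem_mem _
    exact hK (key i hi) (key j hj) (fun e => hij (f.injective e))
  · intro i hi j hj hij
    have key : ∀ i, i ∈ {i : Fin p.toList.length | p.clique.length ≤ i.val} → f i ∉ K := by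
      intro i hi
      rw [hf, List.getElem_append_right (by rw [← el]; exact hi), ← mt]
      exact List.getElem_mem _
    exact hI (key i hi) (key j hj) (fun e => hij (f.injective e))

end

/-- The vertices of the clique part of a splitted list. -/
def Splitted.cliqueSet (p : Splitted) : Set (Fin p.toList.length) := {i | i.val < p.clique.length}

theorem Splitted.lists_get (p : Splitted) : p.Lists p.cliqueSet p.toList.get := by
  have hlen : p.toList.length = p.clique.length + p.indep.length := by simp [Splitted.toList]
  constructor
  · rw [valuesOn_eq (F := (Finset.univ : Finset (Fin p.clique.length)).map
        (Fin.castLEEmb (by omega : p.clique.length ≤ p.toList.length))), Finset.map_val,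
      Multiset.map_map, Fin.univ_val_map]
    · congr 1
      refine List.ext_getElem (by simp) fun i h1 h2 => ?_
      simp only [Splitted.toList, List.getElem_ofFn, Function.comp_apply, List.get_eq_getElem]
      exact (List.getElem_append_left h1).symm
    · intro i
      simp only [Splitted.cliqueSet, Set.mem_ofPred_eq, Finset.mem_univ, true_and, Finset.mem_map]
      exact ⟨by rintro ⟨j, rfl⟩; exact j.2, fun h => ⟨⟨i, h⟩, rfl⟩⟩
  · rw [valuesOn_eq (F := (Finset.univ : Finset (Fin p.indep.length)).map
        ((Fin.natAddEmb p.clique.length).trans (finCongr hlen.symm).toEmbedding)), Finset.map_val,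
      Multiset.map_map, Fin.univ_val_map]
    · congr 1
      refine List.ext_getElem (by simp) fun i h1 h2 => ?_
      have : ∀ h', (p.clique ++ p.indep)[p.clique.length + i]'(h') = p.indep[i] := fun h' => by simp
      simp only [Splitted.toList, List.getElem_ofFn, Function.comp_apply, List.get_eq_getElem]
      exact (this _).symm
    · intro i
      simp only [Splitted.cliqueSet, Set.mem_ofPred_eq, Finset.mem_univ, true_and, Finset.mem_map,
        Set.mem_compl_iff]
      constructor
      · rintro ⟨j, rfl⟩; simp
      · intro h
        refine ⟨⟨i - p.clique.length, by have := i.2; omega⟩, ?_⟩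
        ext; simp; omega

/-- The realization graph of a Tyshkevich composition. -/
theorem exists_iso_comp {p : Splitted} (hp : p.IsDegreeSequence) (q : List ℕ) :
    Nonempty (realizationGraph (p.comp q) ≃g realizationGraph p.toList □ realizationGraph q) := by
  obtain ⟨-, -, G, hG, hK, hI⟩ := hp
  have e : deg G = p.toList.get := funext hG
  have hI' : G.IsIndepSet p.cliqueSetᶜ := by
    convert hI using 1
    ext i; simp [Splitted.cliqueSet]
  obtain ⟨φ⟩ := exists_iso_boxProd (K := p.cliqueSet) hK hI' q.get
  have h : (q : Multiset ℕ) = Finset.univ.val.map q.get := by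
    rw [Fin.univ_val_map, List.ofFn_get]
  obtain ⟨ψ⟩ := exists_iso_of_multiset_eq (p.lists_get.comp h)
  rw [e] at φ
  exact ⟨ψ.trans φ⟩

end

/-! ### 2-switches as symmetric differences; overlaps of alternating 4-cycles. -/

section

variable {V : Type} {H : SimpleGraph V}

theorem exists_switch [Finite V] {u v w x : V} (h : IsAlternating H u v w x) :
    ∃ J : SimpleGraph V, deg J = deg H ∧
      J.edgeSet = (H.edgeSet \ {s(u, v), s(w, x)}) ∪ {s(u, x), s(v, w)} := by
  let J := SimpleGraph.fromEdgeSet ((H.edgeSet \ {s(u, v), s(w, x)}) ∪ {s(u, x), s(v, w)})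
  rw [isAlternating_iff] at h
  obtain ⟨⟨h1, h2, h3, h4, h5, h6⟩, huv, hwx, hux, hvw⟩ := h
  have hJ : ∀ a b, J.Adj a b ↔
      (H.Adj a b ∧ ¬ (s(a, b) = s(u, v) ∨ s(a, b) = s(w, x))) ∨
        (s(a, b) = s(u, x) ∨ s(a, b) = s(v, w)) := by
    intro a b
    simp only [J, SimpleGraph.fromEdgeSet_adj, Set.mem_union, Set.mem_sdiff, Set.mem_insert_iff,
      Set.mem_singleton_iff, SimpleGraph.mem_edgeSet]
    constructor
    · exact fun h => h.1
    · refine fun h => ⟨h, ?_⟩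
      rintro rfl
      simp at h
      grind
  -- Each of the four vertices trades one neighbor `a` for one non-neighbor `b`, so its degree is
  -- unchanged.
  have key : ∀ p a b, H.Adj p a → ¬ H.Adj p b →
      (∀ q, J.Adj p q ↔ q = b ∨ (H.Adj p q ∧ q ≠ a)) → deg J p = deg H p := by
    intro p a b ha hb h
    have : J.neighborSet p = insert b (H.neighborSet p \ {a}) := by ext q; simp [h]
    unfold deg
    rw [this, Set.ncard_exchange (by simpa using hb) (by simpa using ha)]
  refine ⟨J, ?_, ?_⟩
  · ext p
    have hs := H.adj_comm
    by_cases pu : p = u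
    · subst pu
      exact key p v x huv hux fun q => by rw [hJ]; simp only [Sym2.eq_iff]; grind
    by_cases pv : p = v
    · subst pv
      exact key p u w huv.symm hvw fun q => by rw [hJ]; simp only [Sym2.eq_iff]; grind
    by_cases pw : p = w
    · subst pw
      exact key p x v hwx (by rwa [hs]) fun q => by rw [hJ]; simp only [Sym2.eq_iff]; grind
    by_cases px : p = x
    · subst px
      exact key p w u hwx.symm (by rwa [hs]) fun q => by rw [hJ]; simp only [Sym2.eq_iff]; grind
    unfold deg
    congr 1
    ext q
    simp only [SimpleGraph.mem_neighborSet, hJ, Sym2.eq_iff]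
    grind
  · ext e
    induction e with
    | _ a b =>
      rw [SimpleGraph.mem_edgeSet, hJ]
      simp only [Set.mem_union, Set.mem_sdiff, Set.mem_insert_iff, Set.mem_singleton_iff,
        SimpleGraph.mem_edgeSet]

/-- The pairs changed by a 2-switch. -/
noncomputable def cyclePairs (u v w x : V) : Finset (Sym2 V) := {s(u, v), s(w, x), s(u, x), s(v, w)}

theorem card_cyclePairs {u v w x : V} (h : IsAlternating H u v w x) :
    (cyclePairs u v w x).card = 4 := by
  rw [isAlternating_iff] at h
  unfold cyclePairs
  rw [Finset.card_eq_succ]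
  refine ⟨s(u, v), {s(w, x), s(u, x), s(v, w)}, ?_, rfl, ?_⟩
  · simp only [Finset.mem_insert, Finset.mem_singleton, Sym2.eq_iff]; grind
  · rw [Finset.card_eq_three]
    refine ⟨_, _, _, ?_, ?_, ?_, rfl⟩ <;> simp only [ne_eq, Sym2.eq_iff] <;> grind

theorem edgeSet_switch {J : SimpleGraph V} {u v w x : V} (h : IsAlternating H u v w x)
    (hJ : J.edgeSet = (H.edgeSet \ {s(u, v), s(w, x)}) ∪ {s(u, x), s(v, w)}) :
    J.edgeSet = symmDiff H.edgeSet (cyclePairs u v w x) := by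
  rw [isAlternating_iff] at h
  rw [hJ]
  have a1 : s(u, v) ∈ H.edgeSet := h.2.1
  have a2 : s(w, x) ∈ H.edgeSet := h.2.2.1
  have a3 : s(u, x) ∉ H.edgeSet := h.2.2.2.1
  have a4 : s(v, w) ∉ H.edgeSet := h.2.2.2.2
  ext e
  simp only [cyclePairs, Finset.coe_insert, Finset.coe_singleton, Set.mem_symmDiff, Set.mem_union,
    Set.mem_sdiff, Set.mem_insert_iff, Set.mem_singleton_iff]
  grind

/-- Any two realizations of the degrees of `H` differ by a 2-switch. -/
def SwitchComplete (H : SimpleGraph V) : Prop :=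
  ∀ J J' : SimpleGraph V, deg J = deg H → deg J' = deg H → J ≠ J' → TwoSwitch J J'

/-- Let C and C' be the sets of pairs of the two cycles. The two switched graphs differ exactly in C
∆ C'. If they coincide, C = C'. Otherwise they differ by a 2-switch, so 8 - 2|C ∩ C'| = 4. -/
theorem two_le_card_inter [Finite V] (hH : SwitchComplete H) {u v w x u' v' w' x' : V}
    (h : IsAlternating H u v w x) (h' : IsAlternating H u' v' w' x') :
    2 ≤ (cyclePairs u v w x ∩ cyclePairs u' v' w' x').card := by
  obtain ⟨J, dJ, eJ⟩ := exists_switch h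
  obtain ⟨J', dJ', eJ'⟩ := exists_switch h'
  replace eJ := edgeSet_switch h eJ
  replace eJ' := edgeSet_switch h' eJ'
  have c := card_cyclePairs h
  have c' := card_cyclePairs h'
  by_cases e : J = J'
  · subst e
    rw [eJ, symmDiff_right_inj, Finset.coe_inj] at eJ'
    rw [← eJ', Finset.inter_self]; omega
  · obtain ⟨a, b, p, q, h'', e''⟩ := hH J J' dJ dJ' e
    replace e'' := edgeSet_switch h'' e''
    have c'' := card_cyclePairs h''
    rw [eJ, eJ', symmDiff_assoc, symmDiff_right_inj, ← symmDiff_right_inj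
      (a := ((cyclePairs u v w x : Finset (Sym2 V)) : Set (Sym2 V))), symmDiff_symmDiff_cancel_left,
      ← Finset.coe_symmDiff, Finset.coe_inj] at e''
    rw [← e''] at c''
    have h1 := Finset.card_sdiff_add_card_inter (cyclePairs u v w x) (cyclePairs u' v' w' x')
    have h2 := Finset.card_sdiff_add_card_inter (cyclePairs u' v' w' x') (cyclePairs u v w x)
    rw [Finset.inter_comm] at h2
    rw [symmDiff_def, Finset.sup_eq_union, Finset.card_union_of_disjoint disjoint_sdiff_sdiff] at c''
    omega

/-- `(u', v', w', x')` and `(u, v, w, x)` label the same 4-cycle, with the same alternation. -/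
def SameCycle (u' v' w' x' u v w x : V) : Prop :=
  (u' = u ∧ v' = v ∧ w' = w ∧ x' = x) ∨ (u' = w ∧ v' = x ∧ w' = u ∧ x' = v) ∨
    (u' = v ∧ v' = u ∧ w' = x ∧ x' = w) ∨ (u' = x ∧ v' = w ∧ w' = v ∧ x' = u)

/-- A common pair is an edge for both cycles or a non-edge for both. Two opposite common pairs give
the first two alternatives (edges, respectively non-edges, in common) or the same cycle; two
adjacent common pairs form a path, leaving one vertex `y` free. -/
theorem sameCycle_cases [Finite V] (hH : SwitchComplete H) {u v w x u' v' w' x' : V}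
    (h : IsAlternating H u v w x) (h' : IsAlternating H u' v' w' x') :
    SameCycle u' v' w' x' u v x w ∨ SameCycle u' v' w' x' u w v x ∨
      ∃ y, SameCycle u' v' w' x' u v w y ∨ SameCycle u' v' w' x' u v y x ∨
        SameCycle u' v' w' x' u y w x ∨ SameCycle u' v' w' x' y v w x := by
  have := two_le_card_inter hH h h'
  obtain ⟨e, he, f, hf, hef⟩ := Finset.one_lt_card.1 this
  rw [isAlternating_iff] at h h'
  obtain ⟨⟨h1, h2, h3, h4, h5, h6⟩, huv, hwx, hux, hvw⟩ := h
  obtain ⟨⟨h1', h2', h3', h4', h5', h6'⟩, huv', hwx', hux', hvw'⟩ := h'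
  rw [← SimpleGraph.mem_edgeSet] at huv hwx hux hvw huv' hwx' hux' hvw'
  simp only [cyclePairs, Finset.mem_inter, Finset.mem_insert, Finset.mem_singleton] at he hf
  unfold SameCycle
  have key : ∀ e, (e = s(u, v) ∨ e = s(w, x) ∨ e = s(u, x) ∨ e = s(v, w)) ∧
      (e = s(u', v') ∨ e = s(w', x') ∨ e = s(u', x') ∨ e = s(v', w')) →
      (e = s(u, v) ∧ e = s(u', v')) ∨ (e = s(u, v) ∧ e = s(w', x')) ∨
      (e = s(w, x) ∧ e = s(u', v')) ∨ (e = s(w, x) ∧ e = s(w', x')) ∨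
      (e = s(u, x) ∧ e = s(u', x')) ∨ (e = s(u, x) ∧ e = s(v', w')) ∨
      (e = s(v, w) ∧ e = s(u', x')) ∨ (e = s(v, w) ∧ e = s(v', w')) := by
    intro e he
    grind
  clear huv hwx hux hvw huv' hwx' hux' hvw' this
  rcases key e he with ⟨a, b⟩ | ⟨a, b⟩ | ⟨a, b⟩ | ⟨a, b⟩ | ⟨a, b⟩ | ⟨a, b⟩ | ⟨a, b⟩ | ⟨a, b⟩ <;>
  rcases key f hf with ⟨c, d⟩ | ⟨c, d⟩ | ⟨c, d⟩ | ⟨c, d⟩ | ⟨c, d⟩ | ⟨c, d⟩ | ⟨c, d⟩ | ⟨c, d⟩ <;>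
  clear he hf key <;> subst a <;> subst c <;> simp only [Sym2.eq_iff] at b d <;>
  rcases b with ⟨rfl, rfl⟩ | ⟨rfl, rfl⟩ <;> rcases d with ⟨b1, b2⟩ | ⟨b1, b2⟩ <;>
  first
    | exact absurd rfl hef
    | contradiction
    | (subst_vars; simp_all; done)
    | grind

end

/-! ### Three alternating 4-cycles force a sunflower. -/

section

variable {V : Type} {H : SimpleGraph V}

theorem SameCycle.alternating {u' v' w' x' u v w x : V} (h : SameCycle u' v' w' x' u v w x)
    (h' : IsAlternating H u' v' w' x') : IsAlternating H u v w x := by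
  rw [isAlternating_iff] at h' ⊢
  have := H.adj_comm
  rcases h with ⟨rfl, rfl, rfl, rfl⟩ | ⟨rfl, rfl, rfl, rfl⟩ | ⟨rfl, rfl, rfl, rfl⟩ |
    ⟨rfl, rfl, rfl, rfl⟩ <;> grind

theorem SameCycle.trans {a b c d u' v' w' x' u v w x : V} (h : SameCycle a b c d u' v' w' x')
    (h' : SameCycle u' v' w' x' u v w x) : SameCycle a b c d u v w x := by
  unfold SameCycle at *
  rcases h with ⟨rfl, rfl, rfl, rfl⟩ | ⟨rfl, rfl, rfl, rfl⟩ | ⟨rfl, rfl, rfl, rfl⟩ |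
    ⟨rfl, rfl, rfl, rfl⟩ <;> grind

theorem SameCycle.symm {u' v' w' x' u v w x : V} (h : SameCycle u' v' w' x' u v w x) :
    SameCycle u v w x u' v' w' x' := by
  unfold SameCycle at *
  grind

/-- The third cycle is compared with both given ones. A cycle missing part of the path u v w cannot
overlap sufficiently with both, since they have different fourth vertices, unless it is one of them.
-/
theorem sameCycle_of_common_path [Finite V] (hH : SwitchComplete H) {u v w x y a b c d : V}
    (hx : IsAlternating H u v w x) (hy : IsAlternating H u v w y) (hxy : x ≠ y)
    (h : IsAlternating H a b c d) : ∃ z, SameCycle a b c d u v w z := by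
  have key : ∀ {p q r s}, SameCycle a b c d p q r s →
      SameCycle p q r s u v y w ∨ SameCycle p q r s u w v y ∨
      ∃ z, SameCycle p q r s u v w z ∨ SameCycle p q r s u v z y ∨
        SameCycle p q r s u z w y ∨ SameCycle p q r s z v w y :=
    fun hs => sameCycle_cases hH hy (hs.alternating h)
  have hxd := (isAlternating_iff.1 hx)
  have hyd := (isAlternating_iff.1 hy)
  rcases sameCycle_cases hH hx h with h1 | h1 | ⟨z, h1 | h1 | h1 | h1⟩
  all_goals
    have ha := isAlternating_iff.1 (h1.alternating h)
    have k := key h1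
  · unfold SameCycle at k; grind
  · unfold SameCycle at k; grind
  · exact ⟨z, h1⟩
  all_goals by_cases hz : SameCycle a b c d u v w x
  all_goals try exact ⟨x, hz⟩
  all_goals exfalso
  all_goals unfold SameCycle at k h1 hz; grind

/-- Here the four vertices induce 2K₂. Comparing a third cycle with both given cycles leaves no new
possibility. -/
theorem sameCycle_of_opposite_edges [Finite V] (hH : SwitchComplete H) {u v w x a b c d : V}
    (h1 : IsAlternating H u v w x) (h2 : IsAlternating H u v x w)
    (h : IsAlternating H a b c d) : SameCycle a b c d u v w x ∨ SameCycle a b c d u v x w := by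
  have d1 := isAlternating_iff.1 h1
  have d2 := isAlternating_iff.1 h2
  rcases sameCycle_cases hH h1 h with k | k | ⟨z, k | k | k | k⟩
  all_goals
    have ha := isAlternating_iff.1 (k.alternating h)
    have k2 := sameCycle_cases hH h2 (k.alternating h)
  · exact Or.inr k
  · have := H.adj_comm; grind
  all_goals by_cases hz : SameCycle a b c d u v w x
  all_goals try exact Or.inl hz
  all_goals exfalso
  all_goals unfold SameCycle at k k2 hz; grind

/-- The complementary situation, in which the four vertices induce C₄. -/
theorem sameCycle_of_opposite_nonedges [Finite V] (hH : SwitchComplete H) {u v w x a b c d : V}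
    (h1 : IsAlternating H u v w x) (h2 : IsAlternating H u w v x)
    (h : IsAlternating H a b c d) : SameCycle a b c d u v w x ∨ SameCycle a b c d u w v x := by
  have d1 := isAlternating_iff.1 h1
  have d2 := isAlternating_iff.1 h2
  rcases sameCycle_cases hH h1 h with k | k | ⟨z, k | k | k | k⟩
  all_goals
    have ha := isAlternating_iff.1 (k.alternating h)
    have k2 := sameCycle_cases hH h2 (k.alternating h)
  · have := H.adj_comm; grind
  · exact Or.inr k
  all_goals by_cases hz : SameCycle a b c d u v w x
  all_goals try exact Or.inl hz
  all_goals exfalso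
  all_goals unfold SameCycle at k k2 hz; grind

/-- The alternating 4-cycles of `H` are those obtained from the path `u v w` by adding a vertex, and
there are at least two of them. -/
structure IsSunflower (H : SimpleGraph V) (u v w : V) : Prop where
  two : ∃ x y, x ≠ y ∧ IsAlternating H u v w x ∧ IsAlternating H u v w y
  all : ∀ {a b c d}, IsAlternating H a b c d → ∃ z, SameCycle a b c d u v w z

theorem exists_isSunflower [Finite V] (hH : SwitchComplete H)
    {a₁ b₁ c₁ d₁ a₂ b₂ c₂ d₂ a₃ b₃ c₃ d₃ : V} (h₁ : IsAlternating H a₁ b₁ c₁ d₁)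
    (h₂ : IsAlternating H a₂ b₂ c₂ d₂) (h₃ : IsAlternating H a₃ b₃ c₃ d₃)
    (h₁₂ : ¬ SameCycle a₂ b₂ c₂ d₂ a₁ b₁ c₁ d₁) (h₁₃ : ¬ SameCycle a₃ b₃ c₃ d₃ a₁ b₁ c₁ d₁)
    (h₂₃ : ¬ SameCycle a₃ b₃ c₃ d₃ a₂ b₂ c₂ d₂) : ∃ u v w, IsSunflower H u v w := by
  have main : ∀ {u v w x y}, SameCycle a₁ b₁ c₁ d₁ u v w x → SameCycle a₂ b₂ c₂ d₂ u v w y →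
      ∃ u v w, IsSunflower H u v w := by
    intro u v w x y hx hy
    have hxy : x ≠ y := by rintro rfl; exact h₁₂ (hy.trans hx.symm)
    exact ⟨u, v, w, ⟨x, y, hxy, hx.alternating h₁, hy.alternating h₂⟩,
      sameCycle_of_common_path hH (hx.alternating h₁) (hy.alternating h₂) hxy⟩
  rcases sameCycle_cases hH h₁ h₂ with k | k | ⟨z, k | k | k | k⟩
  · exfalso
    rcases sameCycle_of_opposite_edges hH h₁ (k.alternating h₂) h₃ with e | e
    · exact h₁₃ e
    · exact h₂₃ (e.trans k.symm)
  · exfalso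
    rcases sameCycle_of_opposite_nonedges hH h₁ (k.alternating h₂) h₃ with e | e
    · exact h₁₃ e
    · exact h₂₃ (e.trans k.symm)
  · exact main (x := d₁) (by unfold SameCycle; simp) k
  -- In this and the next two cases a symmetry of the cycle moves the shared path to the first three
  -- places.
  · exact main (u := b₁) (v := a₁) (w := d₁) (x := c₁) (y := z)
      (by unfold SameCycle; simp) (k.trans (by unfold SameCycle; simp))
  · exact main (u := c₁) (v := d₁) (w := a₁) (x := b₁) (y := z)
      (by unfold SameCycle; simp) (k.trans (by unfold SameCycle; simp))
  · exact main (u := d₁) (v := c₁) (w := b₁) (x := a₁) (y := z)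
      (by unfold SameCycle; simp) (k.trans (by unfold SameCycle; simp))

theorem SameCycle.cyclePairs_eq {u' v' w' x' u v w x : V} (h : SameCycle u' v' w' x' u v w x) :
    cyclePairs u' v' w' x' = cyclePairs u v w x := by
  ext e
  unfold cyclePairs
  induction e with
  | _ a b =>
    simp only [Finset.mem_insert, Finset.mem_singleton, Sym2.eq_iff]
    rcases h with ⟨rfl, rfl, rfl, rfl⟩ | ⟨rfl, rfl, rfl, rfl⟩ | ⟨rfl, rfl, rfl, rfl⟩ |
      ⟨rfl, rfl, rfl, rfl⟩ <;> grind

theorem exists_isSunflower_of_switchComplete [Finite V] (hH : SwitchComplete H)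
    {J₁ J₂ J₃ : SimpleGraph V} (d₁ : deg J₁ = deg H) (d₂ : deg J₂ = deg H) (d₃ : deg J₃ = deg H)
    (h₁ : H ≠ J₁) (h₂ : H ≠ J₂) (h₃ : H ≠ J₃) (h₁₂ : J₁ ≠ J₂) (h₁₃ : J₁ ≠ J₃) (h₂₃ : J₂ ≠ J₃) :
    ∃ u v w, IsSunflower H u v w := by
  obtain ⟨_, _, _, _, a₁, e₁⟩ := hH H J₁ rfl d₁ h₁
  obtain ⟨_, _, _, _, a₂, e₂⟩ := hH H J₂ rfl d₂ h₂
  obtain ⟨_, _, _, _, a₃, e₃⟩ := hH H J₃ rfl d₃ h₃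
  replace e₁ := edgeSet_switch a₁ e₁
  replace e₂ := edgeSet_switch a₂ e₂
  replace e₃ := edgeSet_switch a₃ e₃
  refine exists_isSunflower hH a₁ a₂ a₃ (fun h => h₁₂ ?_) (fun h => h₁₃ ?_) (fun h => h₂₃ ?_) <;>
    rw [← SimpleGraph.edgeSet_inj]
  · rw [e₁, e₂, h.cyclePairs_eq]
  · rw [e₁, e₃, h.cyclePairs_eq]
  · rw [e₂, e₃, h.cyclePairs_eq]

/-- In the complement, the path is reversed. -/
theorem IsSunflower.compl {u v w : V} (h : IsSunflower H u v w) : IsSunflower Hᶜ w v u := by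
  have hc : ∀ {a b c d}, IsAlternating H a b c d → IsAlternating Hᶜ c b a d := by
    intro a b c d h
    rw [isAlternating_iff] at h ⊢
    have := H.adj_comm
    simp only [SimpleGraph.compl_adj]
    grind
  have hc' : ∀ {a b c d}, IsAlternating Hᶜ a b c d → IsAlternating H c b a d := by
    intro a b c d h
    rw [isAlternating_iff] at h ⊢
    have := H.adj_comm
    simp only [SimpleGraph.compl_adj] at h
    grind
  obtain ⟨x, y, hxy, hx, hy⟩ := h.two
  refine ⟨⟨x, y, hxy, hc hx, hc hy⟩, fun ha => ?_⟩
  obtain ⟨z, hz⟩ := h.all (hc' ha)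
  refine ⟨z, ?_⟩
  unfold SameCycle at hz ⊢
  grind

end

/-! ### Core graphs, their realizations and their degree lists. -/

section

variable {V : Type}

/-- The graph in which `a` is adjacent to all other vertices but `c`, and `b` is adjacent to `c`. -/
def coreGraph (a b c : V) : SimpleGraph V :=
  SimpleGraph.fromRel fun p q => (p = a ∧ q ≠ c) ∨ (p = b ∧ q = c)

theorem coreGraph_adj {a b c p q : V} : (coreGraph a b c).Adj p q ↔
    p ≠ q ∧ (((p = a ∧ q ≠ c) ∨ (p = b ∧ q = c)) ∨ ((q = a ∧ p ≠ c) ∨ (q = b ∧ p = c))) := by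
  simp [coreGraph]

/-- The degrees of a core graph. -/
noncomputable def coreDeg (a b : V) (p : V) : ℕ :=
  if p = a then Nat.card V - 2 else if p = b then 2 else 1

theorem deg_coreGraph [Finite V] {a b c : V} (hab : a ≠ b) (hac : a ≠ c) (hbc : b ≠ c) :
    deg (coreGraph a b c) = coreDeg a b := by
  ext p
  unfold deg coreDeg
  split_ifs with h1 h2
  · subst h1
    have : (coreGraph p b c).neighborSet p = {p, c}ᶜ := by
      ext q; simp only [SimpleGraph.mem_neighborSet, coreGraph_adj, Set.mem_compl_iff,
        Set.mem_insert_iff, Set.mem_singleton_iff]; grind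
    rw [this, Set.ncard_compl, Set.ncard_pair hac]
  · subst h2
    have : (coreGraph a p c).neighborSet p = {a, c} := by
      ext q; simp only [SimpleGraph.mem_neighborSet, coreGraph_adj,
        Set.mem_insert_iff, Set.mem_singleton_iff]; grind
    rw [this, Set.ncard_pair hac]
  · by_cases h3 : p = c
    · subst h3
      have : (coreGraph a b p).neighborSet p = {b} := by
        ext q; simp only [SimpleGraph.mem_neighborSet, coreGraph_adj, Set.mem_singleton_iff]; grind
      rw [this, Set.ncard_singleton]
    · have : (coreGraph a b c).neighborSet p = {a} := by
        ext q; simp only [SimpleGraph.mem_neighborSet, coreGraph_adj, Set.mem_singleton_iff]; grind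
      rw [this, Set.ncard_singleton]

/-- By its degree, a misses exactly one other vertex c. A neighbor of b outside {a, c} would be
adjacent to both a and b although its degree is 1, so the two neighbors of b are a and c. -/
theorem exists_eq_coreGraph [Finite V] {a b : V} (hab : a ≠ b) {G : SimpleGraph V}
    (hG : deg G = coreDeg a b) : ∃ c, a ≠ c ∧ b ≠ c ∧ G = coreGraph a b c := by
  have hN : 2 ≤ Nat.card V := by
    rw [← Set.ncard_pair hab, ← Set.ncard_univ]; exact Set.ncard_le_ncard (Set.subset_univ _)
  have ha : (G.neighborSet a).ncard = Nat.card V - 2 := by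
    have := congrFun hG a; simpa [coreDeg, deg] using this
  have hb : (G.neighborSet b).ncard = 2 := by
    have := congrFun hG b; simpa [coreDeg, deg, hab.symm] using this
  have ho : ∀ p, p ≠ a → p ≠ b → (G.neighborSet p).ncard = 1 := by
    intro p hpa hpb
    have := congrFun hG p; simpa [coreDeg, deg, hpa, hpb] using this
  have ho1 : ∀ p q r, p ≠ a → p ≠ b → G.Adj p q → G.Adj p r → q = r := by
    intro p q r hpa hpb hq hr
    obtain ⟨s, hs⟩ := Set.ncard_eq_one.1 (ho p hpa hpb)
    have hq' : q ∈ G.neighborSet p := hq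
    have hr' : r ∈ G.neighborSet p := hr
    rw [hs] at hq' hr'
    exact hq'.trans hr'.symm
  have hc : ((insert a (G.neighborSet a))ᶜ).ncard = 1 := by
    rw [Set.ncard_compl, Set.ncard_insert_of_notMem (by simp), ha]; omega
  obtain ⟨c, hc⟩ := Set.ncard_eq_one.1 hc
  have hadj : ∀ p, G.Adj a p ↔ p ≠ a ∧ p ≠ c := by
    intro p
    have : p ∈ (insert a (G.neighborSet a))ᶜ ↔ p = c := by rw [hc]; rfl
    simp only [Set.mem_compl_iff, Set.mem_insert_iff, SimpleGraph.mem_neighborSet] at this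
    have := G.loopless.irrefl a
    grind
  have hca : c ≠ a := by
    have : c ∈ (insert a (G.neighborSet a))ᶜ := by rw [hc]; rfl
    simp only [Set.mem_compl_iff, Set.mem_insert_iff, not_or] at this
    exact this.1
  obtain ⟨x, y, hxy, hbxy⟩ := Set.ncard_eq_two.1 hb
  have hbadj : ∀ p, G.Adj b p ↔ p = x ∨ p = y := by
    intro p
    rw [← SimpleGraph.mem_neighborSet, hbxy]; rfl
  have hs := G.adj_comm
  have hi := fun p => G.loopless.irrefl p
  have key : ∀ p, G.Adj b p → p = a ∨ p = c := by
    intro p hp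
    by_contra! h
    have := ho1 p a b h.1 (fun e => hi b (e ▸ hp)) ((hs _ _).1 ((hadj p).2 h)) ((hs _ _).1 hp)
    exact hab this
  have hbx := (hbadj x).2 (Or.inl rfl)
  have hby := (hbadj y).2 (Or.inr rfl)
  have kx := key x hbx
  have ky := key y hby
  have hbc' : G.Adj b c := by clear hbadj key hadj ho1; grind
  have hba' : G.Adj b a := by clear hbadj key hadj ho1; grind
  have hcb : c ≠ b := by rintro rfl; exact hi _ hbc'
  refine ⟨c, hca.symm, hcb.symm, ?_⟩
  ext p q
  rw [coreGraph_adj]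
  by_cases hpa : p = a
  · subst hpa; rw [hadj]; grind
  by_cases hpb : p = b
  · subst hpb; grind
  by_cases hpc : p = c
  · subst hpc
    have := ho1 p q b hpa hpb
    grind
  have := ho1 p q a hpa hpb
  grind

theorem twoSwitch_coreGraph {a b c c' : V} (hab : a ≠ b) (hac : a ≠ c) (hbc : b ≠ c) (hac' : a ≠ c')
    (hbc' : b ≠ c') (h : c ≠ c') : TwoSwitch (coreGraph a b c) (coreGraph a b c') := by
  rw [twoSwitch_iff]
  refine ⟨b, c, a, c', ?_, fun p q => ?_⟩
  · rw [isAlternating_iff]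
    simp only [coreGraph_adj]
    grind
  · simp only [coreGraph_adj, Sym2.eq_iff]
    grind

/-- A realization amounts to the choice of c among the m vertices other than a and b, and exchanging
c for c' is a single 2-switch. -/
theorem exists_iso_coreDeg [Finite V] {a b : V} (hab : a ≠ b) {m : ℕ} (hm : Nat.card V = m + 2) :
    Nonempty (degGraph (coreDeg a b) ≃g (⊤ : SimpleGraph (Fin m))) := by
  let F : ({a, b}ᶜ : Set V) → {G : SimpleGraph V // ∀ v, (G.neighborSet v).ncard = coreDeg a b v} :=
    fun c => ⟨coreGraph a b c, fun v => congrFun (deg_coreGraph hab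
      (fun e => c.2 (Or.inl e.symm)) (fun e => c.2 (Or.inr e.symm))) v⟩
  have hsur : Function.Surjective F := by
    rintro ⟨G, hG⟩
    obtain ⟨c, h1, h2, rfl⟩ := exists_eq_coreGraph hab (funext hG)
    exact ⟨⟨c, by simp [h1.symm, h2.symm]⟩, rfl⟩
  have hsw : ∀ c c', c ≠ c' → TwoSwitch (F c).1 (F c').1 := by
    intro c c' h
    have h1 := c.2
    have h2 := c'.2
    simp only [Set.mem_compl_iff, Set.mem_insert_iff, Set.mem_singleton_iff, not_or] at h1 h2
    exact twoSwitch_coreGraph hab (Ne.symm h1.1) (Ne.symm h1.2) (Ne.symm h2.1) (Ne.symm h2.2)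
      (fun e => h (Subtype.ext e))
  have hinj : Function.Injective F := by
    intro c c' e
    by_contra h
    have := hsw c c' h
    rw [e] at this
    exact TwoSwitch.irrefl _ this
  have htop : degGraph (coreDeg a b) = ⊤ := by
    ext G G'
    rw [SimpleGraph.top_adj]
    refine ⟨fun h => h.ne, fun h => ?_⟩
    obtain ⟨c, rfl⟩ := hsur G
    obtain ⟨c', rfl⟩ := hsur G'
    exact hsw c c' (fun e => h (e ▸ rfl))
  have hcard : Nat.card ({a, b}ᶜ : Set V) = m := by
    rw [Nat.card_coe_set_eq, Set.ncard_compl, Set.ncard_pair hab, hm]; omega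
  rw [htop]
  exact ⟨SimpleGraph.Iso.completeGraph
    ((Equiv.ofBijective F ⟨hinj, hsur⟩).symm.trans (Finite.equivFinOfCardEq hcard))⟩

/-- `G` is a core graph with clique part `K`, or the complement of one. -/
def IsCore (K : Set V) (G : SimpleGraph V) : Prop :=
  ∃ a b c : V, a ≠ b ∧ a ≠ c ∧ b ≠ c ∧
    ((K = {a, b} ∧ G = coreGraph a b c) ∨ (K = {a, b}ᶜ ∧ G = (coreGraph a b c)ᶜ))

theorem IsCore.isClique {K : Set V} {G : SimpleGraph V} (h : IsCore K G) : G.IsClique K := by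
  obtain ⟨a, b, c, hab, hac, hbc, ⟨rfl, rfl⟩ | ⟨rfl, rfl⟩⟩ := h
  · intro p hp q hq hpq
    simp only [Set.mem_insert_iff, Set.mem_singleton_iff] at hp hq
    rw [coreGraph_adj]; grind
  · intro p hp q hq hpq
    simp only [Set.mem_insert_iff, Set.mem_singleton_iff, Set.mem_compl_iff] at hp hq
    rw [SimpleGraph.compl_adj, coreGraph_adj]; grind

theorem IsCore.isIndepSet {K : Set V} {G : SimpleGraph V} (h : IsCore K G) :
    G.IsIndepSet Kᶜ := by
  obtain ⟨a, b, c, hab, hac, hbc, ⟨rfl, rfl⟩ | ⟨rfl, rfl⟩⟩ := h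
  · intro p hp q hq hpq
    simp only [Set.mem_insert_iff, Set.mem_singleton_iff, Set.mem_compl_iff] at hp hq
    rw [coreGraph_adj]; grind
  · intro p hp q hq hpq
    simp only [Set.mem_insert_iff, Set.mem_singleton_iff, compl_compl] at hp hq
    rw [SimpleGraph.compl_adj, coreGraph_adj]; grind

theorem IsCore.exists_iso [Finite V] {K : Set V} {G : SimpleGraph V} (h : IsCore K G) {m : ℕ}
    (hm : Nat.card V = m + 2) : Nonempty (degGraph (deg G) ≃g (⊤ : SimpleGraph (Fin m))) := by
  obtain ⟨a, b, c, hab, hac, hbc, ⟨rfl, rfl⟩ | ⟨rfl, rfl⟩⟩ := h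
  · rw [deg_coreGraph hab hac hbc]
    exact exists_iso_coreDeg hab hm
  · obtain ⟨φ⟩ := exists_iso_coreDeg hab hm
    refine ⟨(degGraphCompl (coreDeg a b) _ fun v => ?_).symm.trans φ⟩
    rw [deg_compl, ← deg_coreGraph hab hac hbc]
    have := deg_le (coreGraph a b c) v
    omega

theorem valuesOn_pair [Fintype V] {a b : V} (hab : a ≠ b) (δ : V → ℕ) :
    valuesOn {a, b} δ = ([δ a, δ b] : List ℕ) := by
  rw [valuesOn_eq (F := {a, b}) (by simp), Finset.insert_val_of_notMem (by simpa using hab)]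
  rfl

theorem valuesOn_const [Fintype V] {S : Set V} {δ : V → ℕ} {k : ℕ} (h : ∀ p ∈ S, δ p = k) :
    valuesOn S δ = (List.replicate S.ncard k : List ℕ) := by
  rw [Multiset.coe_replicate, Multiset.eq_replicate, card_valuesOn]
  refine ⟨rfl, fun x hx => ?_⟩
  obtain ⟨p, hp, rfl⟩ := mem_valuesOn.1 hx
  exact h p hp

theorem ncard_compl_pair [Finite V] {a b : V} (hab : a ≠ b) {m : ℕ} (hm : Nat.card V = m + 2) :
    ({a, b}ᶜ : Set V).ncard = m := by
  rw [Set.ncard_compl, Set.ncard_pair hab, hm]; omega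

theorem lists_coreGraph [Fintype V] {a b c : V} (hab : a ≠ b) (hac : a ≠ c) (hbc : b ≠ c) {m : ℕ}
    (hm : Nat.card V = m + 2) :
    (⟨[m, 2], List.replicate m 1⟩ : Splitted).Lists {a, b} (deg (coreGraph a b c)) := by
  rw [deg_coreGraph hab hac hbc]
  constructor
  · have h1 : coreDeg a b a = m := by rw [coreDeg, if_pos rfl, hm]; rfl
    have h2 : coreDeg a b b = 2 := by rw [coreDeg, if_neg hab.symm, if_pos rfl]
    rw [valuesOn_pair hab, h1, h2]
  · rw [valuesOn_const (k := 1), ncard_compl_pair hab hm]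
    intro p hp
    simp only [Set.mem_insert_iff, Set.mem_singleton_iff, Set.mem_compl_iff, not_or] at hp
    rw [coreDeg, if_neg hp.1, if_neg hp.2]

theorem lists_compl_coreGraph [Fintype V] {a b c : V} (hab : a ≠ b) (hac : a ≠ c) (hbc : b ≠ c)
    {m : ℕ} (hm : Nat.card V = m + 2) :
    (⟨List.replicate m m, [m - 1, 1]⟩ : Splitted).Lists {a, b}ᶜ (deg (coreGraph a b c)ᶜ) := by
  have e : ∀ p, deg (coreGraph a b c)ᶜ p = m + 1 - coreDeg a b p := fun p => by
    rw [deg_compl, deg_coreGraph hab hac hbc, hm]; omega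
  constructor
  · rw [valuesOn_const (k := m), ncard_compl_pair hab hm]
    intro p hp
    simp only [Set.mem_insert_iff, Set.mem_singleton_iff, Set.mem_compl_iff, not_or] at hp
    rw [e, coreDeg, if_neg hp.1, if_neg hp.2]; rfl
  · have h1 : m + 1 - coreDeg a b a = 1 := by rw [coreDeg, if_pos rfl, hm]; omega
    have h2 : m + 1 - coreDeg a b b = m - 1 := by
      rw [coreDeg, if_neg hab.symm, if_pos rfl]; omega
    rw [compl_compl, valuesOn_pair hab, e, e, h1, h2, Multiset.coe_eq_coe]
    -- Complementation reverses the order of the degrees of a and b.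
    exact List.Perm.swap _ _ _

theorem IsCore.exists_lists [Fintype V] {K : Set V} {G : SimpleGraph V} (h : IsCore K G) {m : ℕ}
    (hm2 : 2 ≤ m) (hm : Nat.card V = m + 2) : ∃ α : Splitted, α.clique.Pairwise (· ≥ ·) ∧
      α.indep.Pairwise (· ≥ ·) ∧ α.Lists K (deg G) ∧
      (α.toList = m :: 2 :: List.replicate m 1 ∨ α.toList = List.replicate m m ++ [m - 1, 1]) := by
  obtain ⟨a, b, c, hab, hac, hbc, ⟨rfl, rfl⟩ | ⟨rfl, rfl⟩⟩ := h
  · exact ⟨_, by simpa using hm2, by simp [List.pairwise_replicate],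
      lists_coreGraph hab hac hbc hm, Or.inl rfl⟩
  · exact ⟨_, by simp [List.pairwise_replicate], by simp; omega,
      lists_compl_coreGraph hab hac hbc hm, Or.inr rfl⟩

end

/-! ### From a sunflower to a decomposition as an iterated join. -/

section

variable {V : Type} {H : SimpleGraph V}

/-- `H` is an iterated join `G₁ ∘ (Gα ∘ G₃)` of a split graph, a core graph on at least five
vertices, and a graph. -/
def HasCore (H : SimpleGraph V) : Prop :=
  ∃ (P C M : Set V) (f : P ⊕ (C ⊕ M) ≃ V) (K : Set P) (K' : Set C) (G₁ : SimpleGraph P)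
    (Gα : SimpleGraph C) (G₃ : SimpleGraph M), G₁.IsClique K ∧ G₁.IsIndepSet Kᶜ ∧ IsCore K' Gα ∧
      5 ≤ Nat.card C ∧ H.comap f = join K G₁ (join K' Gα G₃)

/-- Complementing a join complements its parts and exchanges K with its complement; both kinds of
core graph are allowed for this symmetry. -/
theorem HasCore.compl (h : HasCore H) : HasCore Hᶜ := by
  obtain ⟨P, C, M, f, K, K', G₁, Gα, G₃, hK, hI, hc, h5, e⟩ := h
  refine ⟨P, C, M, f, Kᶜ, K'ᶜ, G₁ᶜ, Gαᶜ, G₃ᶜ, ?_, ?_, ?_, h5, ?_⟩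
  · intro p hp q hq hpq
    exact (SimpleGraph.compl_adj ..).2 ⟨hpq, hI hp hq hpq⟩
  · intro p hp q hq hpq h
    rw [compl_compl] at hp hq
    exact ((SimpleGraph.compl_adj ..).1 h).2 (hK hp hq hpq)
  · obtain ⟨a, b, c, hab, hac, hbc, ⟨rfl, rfl⟩ | ⟨rfl, rfl⟩⟩ := hc
    · exact ⟨a, b, c, hab, hac, hbc, Or.inr ⟨rfl, rfl⟩⟩
    · exact ⟨a, b, c, hab, hac, hbc, Or.inl ⟨compl_compl _, compl_compl _⟩⟩
  · rw [← compl_join, ← compl_join, ← e]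
    ext p q
    simp

/-- The vertices of the alternating 4-cycles of a sunflower: the path `v u w` and the set `L` of the
further neighbors of `w`. -/
structure CoreSet (H : SimpleGraph V) (u v w : V) (L : Set V) : Prop where
  uv : H.Adj u v
  uw : H.Adj u w
  not_vw : ¬ H.Adj v w
  ne_vw : v ≠ w
  tip : ∀ z ∈ L, z ≠ u ∧ z ≠ v ∧ z ≠ w ∧ H.Adj w z ∧ ¬ H.Adj u z ∧ ¬ H.Adj v z
  indep : ∀ z ∈ L, ∀ z' ∈ L, ¬ H.Adj z z'
  two : ∃ x ∈ L, ∃ y ∈ L, x ≠ y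
  -- No alternating 4-cycle leaves the set; the distinctness conditions not listed follow from the
  -- adjacencies.
  closed : ∀ a b c d, H.Adj a b → H.Adj c d → ¬ H.Adj a d → ¬ H.Adj b c → a ≠ d → b ≠ c →
    a ∈ insert u (insert v (insert w L)) ∧ b ∈ insert u (insert v (insert w L)) ∧
    c ∈ insert u (insert v (insert w L)) ∧ d ∈ insert u (insert v (insert w L))

theorem isAlternating_of_adj {a b c d : V} (h1 : H.Adj a b) (h2 : H.Adj c d) (h3 : ¬ H.Adj a d)
    (h4 : ¬ H.Adj b c) (h5 : a ≠ d) (h6 : b ≠ c) : IsAlternating H a b c d := by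
  rw [isAlternating_iff]
  have hac : a ≠ c := by rintro rfl; exact h4 h1.symm
  have hbd : b ≠ d := by rintro rfl; exact h3 h1
  exact ⟨⟨h1.ne, hac, h5, h6, hbd, h2.ne⟩, h1, h2, h3, h4⟩

theorem IsSunflower.coreSet {u v w : V} (h : IsSunflower H u v w) (huw : H.Adj u w) :
    CoreSet H u v w {z | IsAlternating H u v w z} := by
  obtain ⟨x, y, hxy, hx, hy⟩ := h.two
  have hL : ∀ z ∈ {z | IsAlternating H u v w z},
      z ≠ u ∧ z ≠ v ∧ z ≠ w ∧ H.Adj w z ∧ ¬ H.Adj u z := by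
    intro z hz
    have := isAlternating_iff.1 hz
    exact ⟨this.1.2.2.1.symm, this.1.2.2.2.2.1.symm, this.1.2.2.2.2.2.symm, this.2.2.1,
      this.2.2.2.1⟩
  have hx' := isAlternating_iff.1 hx
  have huv : H.Adj u v := hx'.2.1
  have hvw : ¬ H.Adj v w := hx'.2.2.2.2
  have hvw' : v ≠ w := hx'.1.2.2.2.1
  refine ⟨huv, huw, hvw, hvw', fun z hz => ?_, fun z hz z' hz' hzz => ?_, ⟨x, hx, y, hy, hxy⟩, ?_⟩
  · obtain ⟨h1, h2, h3, h4, h5⟩ := hL z hz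
    refine ⟨h1, h2, h3, h4, h5, fun hvz => ?_⟩
    -- If v and z were adjacent, the edges uw, vz would give an alternating cycle in which uv is not
    -- an edge of the cycle.
    obtain ⟨t, ht⟩ := h.all (isAlternating_of_adj huw hvz h5 (fun e => hvw e.symm) h1.symm
      hvw'.symm)
    have := huw.ne
    have := huv.ne
    unfold SameCycle at ht
    grind
  · obtain ⟨h1, h2, h3, h4, h5⟩ := hL z hz
    obtain ⟨h1', h2', h3', h4', h5'⟩ := hL z' hz'
    have hzv : ¬ H.Adj z v := by
      intro hvz
      obtain ⟨t, ht⟩ := h.all (isAlternating_of_adj huw hvz.symm h5 (fun e => hvw e.symm) h1.symm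
        hvw'.symm)
      have := huw.ne
      have := huv.ne
      unfold SameCycle at ht
      grind
    -- Adjacent tips z, z' would give an alternating cycle with edges zz', uv, which avoids w.
    obtain ⟨t, ht⟩ := h.all (isAlternating_of_adj hzz huv hzv (fun e => h5' e.symm) h2 h1')
    unfold SameCycle at ht
    grind
  · intro a b c d h1 h2 h3 h4 h5 h6
    have ha := isAlternating_of_adj h1 h2 h3 h4 h5 h6
    obtain ⟨t, ht⟩ := h.all ha
    have ht' := ht.alternating ha
    have : t ∈ {z | IsAlternating H u v w z} := ht'
    simp only [Set.mem_insert_iff]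
    rcases ht with ⟨rfl, rfl, rfl, rfl⟩ | ⟨rfl, rfl, rfl, rfl⟩ | ⟨rfl, rfl, rfl, rfl⟩ |
      ⟨rfl, rfl, rfl, rfl⟩ <;> simp [this]

namespace CoreSet

variable {u v w : V} {L : Set V} (S : CoreSet H u v w L)
include S

/-- This and the next six lemmas share one mechanism: a violation puts an outside vertex on an
alternating 4-cycle, against `closed`. Together they show that an outside vertex sees all of the
core set, none of it, or exactly u and w, and how these three classes are joined. -/
theorem adj_left_iff {p : V} (hp : p ∉ insert u (insert v (insert w L))) :
    H.Adj p u ↔ H.Adj p w := by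
  obtain ⟨x, hx, -⟩ := S.two
  obtain ⟨h1, h2, h3, h4, h5, h6⟩ := S.tip x hx
  have hpw : p ≠ w := by rintro rfl; simp at hp
  have hpu : p ≠ u := by rintro rfl; simp at hp
  by_contra h
  by_cases h' : H.Adj p u
  · exact hp (S.closed u p w x h'.symm h4 h5 (by tauto) h1.symm hpw).2.1
  · have : H.Adj p w := by tauto
    exact hp (S.closed u v w p S.uv this.symm (fun e => h' e.symm) S.not_vw hpu.symm S.ne_vw).2.2.2

theorem adj_tip_iff {p z : V} (hp : p ∉ insert u (insert v (insert w L))) (hz : z ∈ L) :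
    H.Adj p v ↔ H.Adj p z := by
  obtain ⟨h1, h2, h3, h4, h5, h6⟩ := S.tip z hz
  have hpv : p ≠ v := by rintro rfl; simp at hp
  have hpz : p ≠ z := by rintro rfl; simp [hz] at hp
  constructor
  · intro h
    by_contra h'
    exact hp (S.closed p v w z h h4 h' S.not_vw hpz S.ne_vw).1
  · intro h
    by_contra h'
    exact hp (S.closed p z u v h S.uv h' (fun e => h5 e.symm) hpv h1).1

theorem adj_left_of_adj {p : V} (hp : p ∉ insert u (insert v (insert w L))) (h : H.Adj p v) :
    H.Adj p u := by
  have hpu : p ≠ u := by rintro rfl; simp at hp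
  by_contra h'
  exact hp (S.closed p v w u h S.uw.symm h' S.not_vw hpu S.ne_vw).1

theorem clique {p q : V} (hp : p ∉ insert u (insert v (insert w L)))
    (hq : q ∉ insert u (insert v (insert w L))) (h1 : H.Adj p v) (h2 : H.Adj q v) (hpq : p ≠ q) :
    H.Adj p q := by
  obtain ⟨x, hx, -⟩ := S.two
  obtain ⟨-, k1, -, -, -, k2⟩ := S.tip x hx
  by_contra h
  exact hp (S.closed p v x q h1 ((S.adj_tip_iff hq hx).1 h2).symm h k2 hpq k1.symm).1

theorem not_adj {p q : V} (hp : p ∉ insert u (insert v (insert w L)))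
    (hq : q ∉ insert u (insert v (insert w L))) (h1 : ¬ H.Adj p u) (h2 : ¬ H.Adj q u) :
    ¬ H.Adj p q := by
  intro h
  have hpw : p ≠ w := by rintro rfl; simp at hp
  have hqu : q ≠ u := by rintro rfl; simp at hq
  exact hp (S.closed p q u w h S.uw (fun e => h1 ((S.adj_left_iff hp).2 e)) h2 hpw hqu).1

theorem adj_middle {p q : V} (hp : p ∉ insert u (insert v (insert w L)))
    (hq : q ∉ insert u (insert v (insert w L))) (h1 : H.Adj p v) (h2 : ¬ H.Adj q v)
    (h3 : H.Adj q u) : H.Adj p q := by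
  by_contra h
  exact hp (S.closed v p q w h1.symm ((S.adj_left_iff hq).1 h3) S.not_vw h S.ne_vw
    (by rintro rfl; exact h2 h1)).2.1

theorem not_adj_middle {p q : V} (hp : p ∉ insert u (insert v (insert w L)))
    (hq : q ∉ insert u (insert v (insert w L))) (h1 : ¬ H.Adj p u) (h2 : ¬ H.Adj q v) :
    ¬ H.Adj p q := by
  intro h
  have hpu : p ≠ u := by rintro rfl; simp at hp
  have hqv : q ≠ v := by rintro rfl; simp at hq
  exact hp (S.closed p q v u h S.uv.symm h1 h2 hpu hqv).1

theorem five_le_card [Finite V] : 5 ≤ Nat.card (insert u (insert v (insert w L)) : Set V) := by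
  obtain ⟨x, hx, y, hy, hxy⟩ := S.two
  obtain ⟨h1, h2, h3, -⟩ := S.tip x hx
  obtain ⟨k1, k2, k3, -⟩ := S.tip y hy
  have : ({x, y} : Set V) ⊆ L := by
    rintro z (rfl | rfl)
    · exact hx
    · exact hy
  have hL := Set.ncard_le_ncard this
  rw [Set.ncard_pair hxy] at hL
  have tw : w ∉ L := fun h => (S.tip w h).2.2.1 rfl
  have tv : v ∉ insert w L := by
    rintro (h | h)
    · exact S.ne_vw h
    · exact (S.tip v h).2.1 rfl
  have tu : u ∉ insert v (insert w L) := by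
    rintro (h | h | h)
    · exact S.uv.ne h
    · exact S.uw.ne h
    · exact (S.tip u h).1 rfl
  rw [Nat.card_coe_set_eq, Set.ncard_insert_of_notMem tu, Set.ncard_insert_of_notMem tv,
    Set.ncard_insert_of_notMem tw]
  omega

/-- In the core graph, w is the vertex of large degree, u the one of degree 2, and v the leaf
attached to u. -/
theorem adj_iff {p q : V} (hp : p ∈ insert u (insert v (insert w L)))
    (hq : q ∈ insert u (insert v (insert w L))) : H.Adj p q ↔ (coreGraph w u v).Adj p q := by
  have h1 := S.uv
  have h2 := S.uw
  have h3 := S.not_vw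
  have h4 := S.ne_vw
  have h5 := S.tip
  have h6 := S.indep
  have h7 := h1.ne
  have h8 := h2.ne
  have hs := H.adj_comm
  have hi := fun p => H.loopless.irrefl p
  clear S
  rw [coreGraph_adj]
  rcases hp with rfl | rfl | rfl | hp <;> rcases hq with rfl | rfl | rfl | hq
  all_goals grind

theorem hasCore [Finite V] : HasCore H := by
  have hs := H.adj_comm
  let C : Set V := insert u (insert v (insert w L))
  -- `P` collects the outside vertices that see all of `C` (its clique part, detected by v) or none
  -- of it (detected by u); `M` collects those that see exactly u and w.
  let P : Set V := {p | p ∉ C ∧ (H.Adj p v ∨ ¬ H.Adj p u)}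
  let M : Set V := {p | p ∉ C ∧ ¬ H.Adj p v ∧ H.Adj p u}
  let f : P ⊕ (C ⊕ M) → V := Sum.elim (↑) (Sum.elim (↑) (↑))
  have hf : Function.Bijective f := by
    constructor
    · rintro (⟨p, hp⟩ | ⟨p, hp⟩ | ⟨p, hp⟩) (⟨q, hq⟩ | ⟨q, hq⟩ | ⟨q, hq⟩) e <;>
        change p = q at e <;> subst e <;>
        first
          | rfl
          | exact absurd hq hp.1
          | exact absurd hp hq.1
          | exact absurd hq.2 (fun h => hp.2.elim h.1 fun e => e h.2)
          | exact absurd hp.2 (fun h => hq.2.elim h.1 fun e => e h.2)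
    · intro p
      by_cases hp : p ∈ C
      · exact ⟨.inr (.inl ⟨p, hp⟩), rfl⟩
      by_cases hp' : H.Adj p v ∨ ¬ H.Adj p u
      · exact ⟨.inl ⟨p, hp, hp'⟩, rfl⟩
      · push Not at hp'
        exact ⟨.inr (.inr ⟨p, hp, hp'⟩), rfl⟩
  have cu : u ∈ C := Or.inl rfl
  have cv : v ∈ C := Or.inr (Or.inl rfl)
  have cw : w ∈ C := Or.inr (Or.inr (Or.inl rfl))
  refine ⟨P, C, M, Equiv.ofBijective f hf, {p | H.Adj p v}, {⟨w, cw⟩, ⟨u, cu⟩},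
    H.comap (↑), coreGraph ⟨w, cw⟩ ⟨u, cu⟩ ⟨v, cv⟩, H.comap (↑), ?_, ?_, ?_, S.five_le_card, ?_⟩
  · rintro ⟨p, hp⟩ h1 ⟨q, hq⟩ h2 hpq
    exact S.clique hp.1 hq.1 h1 h2 (fun e => hpq (Subtype.ext e))
  · rintro ⟨p, hp⟩ h1 ⟨q, hq⟩ h2 hpq
    exact S.not_adj hp.1 hq.1 (hp.2.resolve_left h1) (hq.2.resolve_left h2)
  · refine ⟨⟨w, cw⟩, ⟨u, cu⟩, ⟨v, cv⟩, ?_, ?_, ?_, Or.inl ⟨rfl, rfl⟩⟩ <;>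
      simp only [ne_eq, Subtype.mk.injEq]
    · exact S.uw.ne'
    · exact S.ne_vw.symm
    · exact S.uv.ne
  · have inl : ∀ p (hp : p ∈ P) q (hq : q ∈ C ∨ q ∈ M), H.Adj p q ↔ H.Adj p v := by
      rintro p ⟨hp, hp'⟩ q (hq | ⟨h1, h2, h3⟩)
      · have h1 := S.adj_left_iff hp
        have h2 := S.adj_left_of_adj hp
        rcases hq with rfl | rfl | rfl | hq
        · tauto
        · rfl
        · tauto
        · exact (S.adj_tip_iff hp hq).symm
      · have k1 := fun h => S.adj_middle hp h1 h h2 h3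
        have k2 := fun h => S.not_adj_middle hp h1 h h2
        tauto
    have core : ∀ p (hp : p ∈ C) q (hq : q ∈ C), H.Adj p q ↔
        (coreGraph ⟨w, cw⟩ ⟨u, cu⟩ ⟨v, cv⟩ : SimpleGraph C).Adj ⟨p, hp⟩ ⟨q, hq⟩ := by
      intro p hp q hq
      rw [S.adj_iff hp hq, coreGraph_adj, coreGraph_adj]
      simp only [ne_eq, Subtype.mk.injEq]
    have cm : ∀ p (hp : p ∈ C) q (hq : q ∈ M), H.Adj p q ↔
        (⟨p, hp⟩ : C) ∈ ({⟨w, cw⟩, ⟨u, cu⟩} : Set C) := by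
      rintro p hp q ⟨h1, h2, h3⟩
      have k1 := S.adj_left_iff h1
      simp only [Set.mem_insert_iff, Set.mem_singleton_iff, Subtype.mk.injEq]
      rw [hs]
      rcases hp with rfl | rfl | rfl | hp
      · tauto
      · have := S.ne_vw
        have := S.uv.ne
        grind
      · tauto
      · have := S.tip p hp
        rw [← S.adj_tip_iff h1 hp]
        tauto
    ext (⟨p, hp⟩ | ⟨p, hp⟩ | ⟨p, hp⟩) (⟨q, hq⟩ | ⟨q, hq⟩ | ⟨q, hq⟩)
    · rfl
    · exact inl p hp q (Or.inl hq)
    · exact inl p hp q (Or.inr hq)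
    · exact (hs p q).trans (inl q hq p (Or.inl hp))
    · exact core p hp q hq
    · exact cm p hp q hq
    · exact (hs p q).trans (inl q hq p (Or.inr hp))
    · exact (hs p q).trans (cm q hq p hp)
    · rfl

end CoreSet

theorem IsSunflower.hasCore [Finite V] {u v w : V} (h : IsSunflower H u v w) : HasCore H := by
  by_cases huw : H.Adj u w
  · exact (h.coreSet huw).hasCore
  · have hne : w ≠ u := by
      obtain ⟨x, -, -, hx, -⟩ := h.two
      exact (isAlternating_iff.1 hx).1.2.1.symm
    have := (h.compl.coreSet
      ((SimpleGraph.compl_adj ..).2 ⟨hne, fun e => huw e.symm⟩)).hasCore.compl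
    rwa [compl_compl] at this

end

/-! ### Complete Cartesian products and the assembly of the theorem. -/

section

variable {V : Type}

/-- The Cartesian product with a one-vertex graph. -/
theorem exists_iso_boxProd_left {α β : Type*} [Nonempty α] [Subsingleton α] (G : SimpleGraph α)
    (G' : SimpleGraph β) : Nonempty (G.boxProd G' ≃g G') := by
  have : Unique α := Nonempty.some ⟨uniqueOfSubsingleton (Classical.arbitrary α)⟩
  refine ⟨⟨Equiv.uniqueProd β α, ?_⟩⟩
  rintro ⟨a, b⟩ ⟨a', b'⟩
  obtain rfl := Subsingleton.elim a a'
  simp [SimpleGraph.boxProd_adj]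

theorem exists_iso_boxProd_right {α β : Type*} [Nonempty α] [Subsingleton α] (G : SimpleGraph α)
    (G' : SimpleGraph β) : Nonempty (G'.boxProd G ≃g G') := by
  obtain ⟨φ⟩ := exists_iso_boxProd_left G G'
  exact ⟨(SimpleGraph.boxProdComm G' G).trans φ⟩

theorem adj_of_iso_top {α : Type*} {G : SimpleGraph α} {n : ℕ}
    (φ : G ≃g (⊤ : SimpleGraph (Fin n))) {x y : α} (h : x ≠ y) : G.Adj x y := by
  rw [← φ.map_adj_iff, SimpleGraph.top_adj]
  exact fun e => h (φ.injective e)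

/-- Pairs differing in both coordinates are never adjacent in a Cartesian product. -/
theorem subsingleton_left_of_boxProd {α β : Type*} {G : SimpleGraph α} {G' : SimpleGraph β} {n : ℕ}
    (φ : G.boxProd G' ≃g (⊤ : SimpleGraph (Fin n))) {b b' : β} (h : b ≠ b') : Subsingleton α := by
  refine ⟨fun a a' => ?_⟩
  by_contra ha
  have := adj_of_iso_top φ (x := (a, b)) (y := (a', b')) (fun e => ha (congrArg Prod.fst e))
  simp [SimpleGraph.boxProd_adj, ha, h] at this

theorem eq_of_iso_top {α : Type*} {G : SimpleGraph α} {m n : ℕ}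
    (φ : G ≃g (⊤ : SimpleGraph (Fin m))) (ψ : G ≃g (⊤ : SimpleGraph (Fin n))) : m = n := by
  simpa using Fintype.card_congr (φ.symm.toEquiv.trans ψ.toEquiv)

/-- A threefold product containing a nontrivial complete factor is complete only if the other
factors are trivial. -/
theorem of_boxProd_iso_top {α β γ : Type*} {A : SimpleGraph α} {B : SimpleGraph β}
    {C : SimpleGraph γ} [Nonempty α] [Nonempty γ] {m n : ℕ} (hm : 2 ≤ m)
    (φ : A.boxProd (B.boxProd C) ≃g (⊤ : SimpleGraph (Fin n))) (ψ : B ≃g (⊤ : SimpleGraph (Fin m))) :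
    Subsingleton α ∧ Subsingleton γ ∧ m = n := by
  have hb : ψ.symm ⟨0, by omega⟩ ≠ ψ.symm ⟨1, by omega⟩ := by simp
  have c : γ := Classical.arbitrary γ
  have hα := subsingleton_left_of_boxProd φ
    (b := (ψ.symm ⟨0, by omega⟩, c)) (b' := (ψ.symm ⟨1, by omega⟩, c)) (by simp)
  obtain ⟨χ⟩ := exists_iso_boxProd_left A (B.boxProd C)
  have φ' := χ.symm.trans φ
  have hγ := subsingleton_left_of_boxProd ((SimpleGraph.boxProdComm C B).trans φ') hb
  obtain ⟨χ'⟩ := exists_iso_boxProd_right C B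
  exact ⟨hα, hγ, eq_of_iso_top ψ (χ'.symm.trans φ')⟩

theorem switchComplete_of_iso {H : SimpleGraph V} {n : ℕ}
    (φ : degGraph (deg H) ≃g (⊤ : SimpleGraph (Fin n))) : SwitchComplete H := by
  intro J J' h h' hne
  have := adj_of_iso_top φ (x := ⟨J, congrFun h⟩) (y := ⟨J', congrFun h'⟩)
    (fun e => hne (Subtype.ext_iff.1 e))
  exact this

theorem hasCore_of_iso [Finite V] {H : SimpleGraph V} {n : ℕ} (hn : 4 ≤ n)
    (φ : degGraph (deg H) ≃g (⊤ : SimpleGraph (Fin n))) : HasCore H := by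
  -- Here n ≥ 4 enters: it supplies three distinct realizations other than `H`.
  have hc : 2 < (Finset.univ.erase (φ ⟨H, fun _ => rfl⟩)).card := by
    rw [Finset.card_erase_of_mem (Finset.mem_univ _), Finset.card_univ, Fintype.card_fin]; omega
  obtain ⟨i, j, k, hi, hj, hk, hij, hik, hjk⟩ := Finset.two_lt_card_iff.1 hc
  have inj : ∀ {i j}, i ≠ j → (φ.symm i).1 ≠ (φ.symm j).1 :=
    fun h e => h (φ.symm.injective (Subtype.ext e))
  have ne : ∀ {i}, i ∈ Finset.univ.erase (φ ⟨H, fun _ => rfl⟩) → H ≠ (φ.symm i).1 := by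
    intro i hi e
    have h : φ.symm i = ⟨H, fun _ => rfl⟩ := Subtype.ext e.symm
    rw [← h] at hi
    simp at hi
  obtain ⟨u, v, w, h⟩ := exists_isSunflower_of_switchComplete (switchComplete_of_iso φ)
    (funext (φ.symm i).2) (funext (φ.symm j).2) (funext (φ.symm k).2) (ne hi) (ne hj) (ne hk)
    (inj hij) (inj hik) (inj hjk)
  exact h.hasCore

theorem pairwise_sort (s : Multiset ℕ) : (s.sort (· ≥ ·)).Pairwise (· ≥ ·) :=
  Multiset.pairwise_sort s _

theorem isThreshold_of_subsingleton [Fintype V] {G : SimpleGraph V} {d : List ℕ}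
    (hd : d.Pairwise (· ≥ ·)) (hm : (d : Multiset ℕ) = Finset.univ.val.map (deg G))
    (h : Subsingleton {J : SimpleGraph V // ∀ v, (J.neighborSet v).ncard = deg G v}) :
    IsThreshold d := by
  obtain ⟨φ⟩ := exists_iso_of_multiset_eq hm
  let R := φ.symm ⟨G, fun _ => rfl⟩
  refine ⟨⟨hd, R.1, R.2⟩, R.1, R.2, fun J hJ => ?_⟩
  have : (⟨J, hJ⟩ : Realization d) = R := φ.injective (Subsingleton.elim _ _)
  exact Subtype.ext_iff.1 this

/-- Reading off a composition from an iterated join. -/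
theorem HasCore.exists_comp [Fintype V] {H : SimpleGraph V} (h : HasCore H) {d : List ℕ}
    (hd : d.Pairwise (· ≥ ·)) (hm : (d : Multiset ℕ) = Finset.univ.val.map (deg H)) {n : ℕ}
    (φ : realizationGraph d ≃g (⊤ : SimpleGraph (Fin n))) :
    ∃ (t α : Splitted) (t' : List ℕ),
        t.IsDegreeSequence ∧ (t.toList = [] ∨ IsThreshold t.toList) ∧
        α.IsDegreeSequence ∧
          (α.toList = n :: 2 :: List.replicate n 1 ∨
            α.toList = List.replicate n n ++ [n - 1, 1]) ∧
        (t' = [] ∨ IsThreshold t') ∧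
        d = t.comp (α.comp t') := by
  obtain ⟨P, C, M, f, K, K', G₁, Gα, G₃, hK, hI, hc, h5, e⟩ := h
  obtain ⟨m, hcard⟩ : ∃ m, Nat.card C = m + 2 := ⟨Nat.card C - 2, by omega⟩
  have hm2 : 2 ≤ m := by omega
  have hdm : (d : Multiset ℕ) =
      Finset.univ.val.map (deg (join K G₁ (join K' Gα G₃))) := by
    rw [hm, ← e, show deg (H.comap f) = deg H ∘ f from funext (deg_comap H f), ← Multiset.map_map]
    congr 1
    rw [← Finset.map_univ_equiv f]
    rfl
  obtain ⟨φ₀⟩ := exists_iso_of_multiset_eq hdm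
  rw [deg_join] at φ₀
  obtain ⟨φ₁⟩ := exists_iso_boxProd hK hI (deg (join K' Gα G₃))
  obtain ⟨φ₂⟩ := exists_iso_boxProd hc.isClique hc.isIndepSet (deg G₃)
  rw [← deg_join] at φ₂
  obtain ⟨ψ⟩ := hc.exists_iso hcard
  have φ₃ : (degGraph (deg G₁)).boxProd ((degGraph (deg Gα)).boxProd (degGraph (deg G₃))) ≃g
      (⊤ : SimpleGraph (Fin n)) :=
    (⟨Equiv.prodCongr (Equiv.refl _) φ₂.symm.toEquiv, by
      rintro ⟨a, b⟩ ⟨a', b'⟩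
      have := φ₂.symm.map_adj_iff (v := b) (w := b')
      simp [SimpleGraph.boxProd_adj, SimpleGraph.boxProd_adj] at this ⊢
      simp [this]⟩ : _ ≃g _).trans (φ₁.symm.trans (φ₀.symm.trans φ))
  have : Nonempty {J : SimpleGraph P // ∀ v, (J.neighborSet v).ncard = deg G₁ v} :=
    ⟨⟨G₁, fun _ => rfl⟩⟩
  have : Nonempty {J : SimpleGraph M // ∀ v, (J.neighborSet v).ncard = deg G₃ v} :=
    ⟨⟨G₃, fun _ => rfl⟩⟩
  -- The core factor K_m is nontrivial, so the other two factors are single vertices and m = n.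
  obtain ⟨h₁, h₃, rfl⟩ := of_boxProd_iso_top hm2 φ₃ ψ
  obtain ⟨α, hα₁, hα₂, hα, hlist⟩ := hc.exists_lists hm2 hcard
  let t : Splitted := ⟨(valuesOn K (deg G₁)).sort (· ≥ ·), (valuesOn Kᶜ (deg G₁)).sort (· ≥ ·)⟩
  have ht : t.Lists K (deg G₁) := ⟨Multiset.sort_eq .., Multiset.sort_eq ..⟩
  have ht₁ : t.clique.Pairwise (· ≥ ·) := pairwise_sort _
  have ht₂ : t.indep.Pairwise (· ≥ ·) := pairwise_sort _
  have hq : ((Finset.univ.val.map (deg G₃)).sort (· ≥ ·) : Multiset ℕ) =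
    Finset.univ.val.map (deg G₃) := Multiset.sort_eq ..
  refine ⟨t, α, (Finset.univ.val.map (deg G₃)).sort (· ≥ ·),
    isDegreeSequence_of_lists hK hI ht ht₁ ht₂,
    -- The empty list also has exactly one realization, so the threshold alternative covers an empty
    -- `P` or `M`.
    Or.inr (isThreshold_of_subsingleton (pairwise_toList hK hI ht ht₁ ht₂) ht.toList h₁),
    isDegreeSequence_of_lists hc.isClique hc.isIndepSet hα hα₁ hα₂, hlist,
    Or.inr (isThreshold_of_subsingleton (pairwise_sort _) hq h₃), ?_⟩
  exact eq_comp hK hI ht ht₁ ht₂ hd hdm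
    (pairwise_comp hc.isClique hc.isIndepSet hα hα₁ hα₂ (pairwise_sort _) hq)
    (by rw [deg_join, hα.comp hq])

theorem exists_iso_of_core_list {n : ℕ} (hn : 2 ≤ n) {d : List ℕ}
    (h : d = n :: 2 :: List.replicate n 1 ∨ d = List.replicate n n ++ [n - 1, 1]) :
    Nonempty (realizationGraph d ≃g (⊤ : SimpleGraph (Fin n))) := by
  have hcard : Nat.card (Fin (n + 2)) = n + 2 := by simp
  let a : Fin (n + 2) := ⟨0, by omega⟩
  let b : Fin (n + 2) := ⟨1, by omega⟩
  let c : Fin (n + 2) := ⟨2, by omega⟩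
  have key : ∀ {K G}, IsCore (V := Fin (n + 2)) K G →
      (d : Multiset ℕ) = Finset.univ.val.map (deg G) →
      Nonempty (realizationGraph d ≃g (⊤ : SimpleGraph (Fin n))) := by
    intro K G hc hd
    obtain ⟨φ⟩ := exists_iso_of_multiset_eq hd
    obtain ⟨ψ⟩ := hc.exists_iso hcard
    exact ⟨φ.trans ψ⟩
  have hab : a ≠ b := by simp [a, b]
  have hac : a ≠ c := by simp [a, c]
  have hbc : b ≠ c := by simp [b, c]
  rcases h with rfl | rfl
  · exact key ⟨a, b, c, hab, hac, hbc, Or.inl ⟨rfl, rfl⟩⟩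
      (lists_coreGraph hab hac hbc hcard).toList
  · exact key ⟨a, b, c, hab, hac, hbc, Or.inr ⟨rfl, rfl⟩⟩
      (lists_compl_coreGraph hab hac hbc hcard).toList

theorem nonempty_and_subsingleton {d : List ℕ} (h : d = [] ∨ IsThreshold d) :
    Nonempty (Realization d) ∧ Subsingleton (Realization d) := by
  rcases h with rfl | h
  · have : IsEmpty (Fin ([] : List ℕ).length) := inferInstanceAs (IsEmpty (Fin 0))
    exact ⟨⟨⟨⊥, fun i => isEmptyElim i⟩⟩, ⟨fun G G' => Subtype.ext (Subsingleton.elim _ _)⟩⟩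
  · obtain ⟨-, G, hG, hu⟩ := h
    exact ⟨⟨⟨G, hG⟩⟩, ⟨fun J J' => Subtype.ext ((hu _ J.2).trans (hu _ J'.2).symm)⟩⟩

end

end DegSeq

theorem mainTheorem3 (n : ℕ) (hn : 4 ≤ n) (d : List ℕ) (hd : DegSeq.IsDegreeSequence d) :
    Nonempty (DegSeq.realizationGraph d ≃g (⊤ : SimpleGraph (Fin n))) ↔
      ∃ (t α : DegSeq.Splitted) (t' : List ℕ),
        t.IsDegreeSequence ∧ (t.toList = [] ∨ DegSeq.IsThreshold t.toList) ∧
        α.IsDegreeSequence ∧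
          (α.toList = n :: 2 :: List.replicate n 1 ∨
            α.toList = List.replicate n n ++ [n - 1, 1]) ∧
        (t' = [] ∨ DegSeq.IsThreshold t') ∧
        d = t.comp (α.comp t') := by
  constructor
  · rintro ⟨φ⟩
    obtain ⟨hs, H, hH⟩ := hd
    have e : DegSeq.deg H = d.get := funext hH
    have hm : (d : Multiset ℕ) = Finset.univ.val.map (DegSeq.deg H) := by
      rw [e, Fin.univ_val_map, List.ofFn_get]
    have φ' : DegSeq.degGraph (DegSeq.deg H) ≃g (⊤ : SimpleGraph (Fin n)) := by rw [e]; exact φ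
    exact (DegSeq.hasCore_of_iso hn φ').exists_comp hs hm φ
  · rintro ⟨t, α, t', ht, htt, hα, hαl, ht', rfl⟩
    obtain ⟨φ⟩ := DegSeq.exists_iso_comp ht (α.comp t')
    obtain ⟨φ'⟩ := DegSeq.exists_iso_comp hα t'
    obtain ⟨ψ⟩ := DegSeq.exists_iso_of_core_list (by omega) hαl
    obtain ⟨_, _⟩ := DegSeq.nonempty_and_subsingleton htt
    obtain ⟨_, _⟩ := DegSeq.nonempty_and_subsingleton ht'
    obtain ⟨χ⟩ := DegSeq.exists_iso_boxProd_left (DegSeq.realizationGraph t.toList)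
      (DegSeq.realizationGraph (α.comp t'))
    obtain ⟨χ'⟩ := DegSeq.exists_iso_boxProd_right (DegSeq.realizationGraph t')
      (DegSeq.realizationGraph α.toList)
    exact ⟨φ.trans (χ.trans (φ'.trans (χ'.trans ψ)))⟩
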